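/- Let $1\le k\le m\le n$ be integers, let $c\ge 0$ and $\lambda,\tilde\mu>0$ be real numbers, and let $(Z_{t,j})$ and $(\tilde X_{t,j})$ ($t=0,1,2,\dots$; $1\le j\le n$) be mutually independent random variables, where each $Z_{t,j}$ is exponential with rate $\lambda$ and each $\tilde X_{t,j}$ is exponential with rate $\tilde\mu$. Consider a server with $n$ clients that proceeds in iterations. Before iteration $t$ the server waits until $m$ clients are available, client $j$ becoming available $Z_{t,j}$ time units after the waiting started; it starts waiting for iteration $0$ at time $0$, and for iteration $t+1$ as soon as iteration $t$ is complete. When the $m$-th client becomes available, at time $T_t$ say, the server sends its current model, without delay, to these $m$ clients. Each of them generates its update at time $T_t+c$, and the update of client $j$ would reach the server at time $T_t+c+\tilde X_{t,j}$. The server uses only the earliest $k$ of these $m$ updates, and iteration $t$ is complete when the $k$-th of them has been received. The age of client $j$ at time $\tau\ge 0$ is $\Delta_j(\tau)=\tau-u_j(\tau)$, where $u_j(\tau)$ is the generation time of the most recent update of client $j$ that was used by the server and received by time $\tau$; before the first such update $u_j(\tau)=u_{j,0}$, where $u_{j,0}\le 0$ is an arbitrary constant. Let $\tilde X_{i:m}$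 be the $i$-th smallest of $m$ independent exponential($\tilde\mu$) random variables and $Z_{m:n}$ the $m$-th smallest of $n$ independent exponential($\lambda$) random variables. The order statistics $\tilde X_{i:m}$ ($1\le i\le k$) and $Z_{m:n}$ are square integrable, $c+\mathbb{E}[\tilde X_{k:m}]+\mathbb{E}[Z_{m:n}]>0$, and for every client $j$, almost surely $\Delta_j(\cdot)$ is integrable on $[0,T]$ for every $T\ge 0$ and $$\lim_{T\to\infty}\frac1T\int_0^T\Delta_j(\tau)\,d\tau=\frac1k\sum_{i=1}^k\mathbb{E}[\tilde X_{i:m}]+\frac{2n-k}{2k}\bigl(c+\mathbb{E}[\tilde X_{k:m}]+\mathbb{E}[Z_{m:n}]\bigr)+\frac{\mathrm{Var}[\tilde X_{k:m}]+\mathrm{Var}[Z_{m:n}]}{2\bigl(c+\mathbb{E}[\tilde X_{k:m}]+\mathbb{E}[Z_{m:n}]\bigr)}.$$ -/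

import Mathlib

open MeasureTheory ProbabilityTheory Filter Topology

namespace TimelyFL

/-- The `i`-th order statistic (`1 ≤ i ≤ #s`) of the values `v j`, `j ∈ s`: the least real `r`
such that at least `i` of these values are at most `r`, i.e. the `i`-th smallest value. -/
noncomputable def orderStat {ι : Type*} (s : Finset ι) (v : ι → ℝ) (i : ℕ) : ℝ :=
  sInf {r : ℝ | i ≤ (s.filter (fun j => v j ≤ r)).card}

/-- The earliest `i` elements of `s` when `j ∈ s` occurs at time `v j`
(exactly `i` elements whenever the times are pairwise distinct). -/
noncomputable def earliest {ι : Type*} (s : Finset ι) (v : ι → ℝ) (i : ℕ) : Finset ι :=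
  s.filter (fun j => v j ≤ orderStat s v i)

/-- Deterministic parameters and one realization of the delays for the scheme with `n` clients.
The iterations are numbered `0, 1, 2, …`. -/
structure Run (n : ℕ) where
  /-- number of available clients that the server waits for -/
  m : ℕ
  /-- number of updates that the server uses in an iteration -/
  k : ℕ
  /-- computation time of a client -/
  c : ℝ
  /-- `z t j`: time from the moment the server starts waiting for iteration `t`
  until client `j` becomes available -/
  z : ℕ → Fin n → ℝ
  /-- `x t j`: uplink delay of client `j` in iteration `t` -/
  x : ℕ → Fin n → ℝ

namespace Run

variable {n : ℕ}

/-- The time the server waits before iteration `t` until `m` clients are available. -/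
noncomputable def waitTime (R : Run n) (t : ℕ) : ℝ :=
  orderStat Finset.univ (R.z t) R.m

/-- The first `m` available clients, to which the model is sent in iteration `t`. -/
noncomputable def selected (R : Run n) (t : ℕ) : Finset (Fin n) :=
  earliest Finset.univ (R.z t) R.m

/-- The clients whose updates are used in iteration `t`: among the selected ones, those with the
earliest `k` updates (all updates are generated simultaneously, so the uplink delays decide). -/
noncomputable def updating (R : Run n) (t : ℕ) : Finset (Fin n) :=
  earliest (R.selected t) (R.x t) R.k

/-- The time from the broadcast of the model in iteration `t` until the server has received
the earliest `k` updates from the selected clients. -/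
noncomputable def serviceTime (R : Run n) (t : ℕ) : ℝ :=
  orderStat (R.selected t) (fun j => R.c + R.x t j) R.k

/-- The time at which the model of iteration `t` is broadcast. The server starts waiting for the
first iteration at time `0`, and for iteration `t + 1` as soon as iteration `t` is complete. -/
noncomputable def startTime (R : Run n) : ℕ → ℝ
  | 0 => R.waitTime 0
  | t + 1 => R.startTime t + R.serviceTime t + R.waitTime (t + 1)

/-- The time at which the selected clients of iteration `t` have generated their updates
(the downlink is instantaneous). -/
noncomputable def genTime (R : Run n) (t : ℕ) : ℝ := R.startTime t + R.c

/-- The generation time of the most recent update of client `j` available at the server at time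
`τ`; `u₀` is the generation time of the information on client `j` held at time `0`. -/
noncomputable def lastGenTime (R : Run n) (u₀ : ℝ) (j : Fin n) (τ : ℝ) : ℝ :=
  sSup (insert u₀ {g : ℝ | ∃ t : ℕ, j ∈ R.updating t ∧ R.genTime t + R.x t j ≤ τ ∧
    g = R.genTime t})

/-- The instantaneous age of client `j` at the server at time `τ`. -/
noncomputable def age (R : Run n) (u₀ : ℝ) (j : Fin n) (τ : ℝ) : ℝ :=
  τ - R.lastGenTime u₀ j τ

end Run

/-- `L` is the long-term average of `f` over `[0, ∞)`. -/
def IsLongTermAverage (f : ℝ → ℝ) (L : ℝ) : Prop :=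
  (∀ T : ℝ, 0 ≤ T → IntervalIntegrable f volume 0 T) ∧
    Tendsto (fun T : ℝ => (1 / T) * ∫ τ in (0 : ℝ)..T, f τ) atTop (𝓝 L)

/-- The joint law of `N` i.i.d. exponential random variables with rate `r`. -/
noncomputable def iidExp (r : ℝ) (N : ℕ) : Measure (Fin N → ℝ) :=
  Measure.pi (fun _ => expMeasure r)

/-- The `i`-th order statistic of `N` random variables, on the space of their values. -/
noncomputable def os (N i : ℕ) : (Fin N → ℝ) → ℝ :=
  fun v => orderStat Finset.univ v i

/-- The mean of the `i`-th order statistic of `N` i.i.d. exponential(`r`) random variables. -/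
noncomputable def meanOS (r : ℝ) (N i : ℕ) : ℝ := ∫ v, os N i v ∂(iidExp r N)

/-- The variance of the `i`-th order statistic of `N` i.i.d. exponential(`r`) random variables. -/
noncomputable def varOS (r : ℝ) (N i : ℕ) : ℝ := variance (os N i) (iidExp r N)

end TimelyFL

/-!
Split time at the completions of the iterations. The delays `ξ t` of iteration `t` (availability
times and uplink delays of all clients) are i.i.d. in `t`. Let `W` be the waiting time, `Y` the
`k`-th smallest uplink delay among the selected clients, `L = W + c + Y` the duration of the
iteration, `B` the indicator of the event that client `j` is updating, and `x` its uplink delay. If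
`b t` is the age of client `j` when the server starts waiting for iteration `t`, then
`b (t + 1) = (1 - B) (b t + L) + B Y`, and the area under the age during iteration `t` is
`L² / 2 - B (W + c) (Y - x) + b t * ((1 - B) L + B (W + c + x))`
(`Run.Admissible.integral_age_iteration`). So no excursions between successive updates of a client
are needed, only an affine recursion `b` whose value `b t` is independent of `ξ t`.

The averages of i.i.d. terms converge by the strong law of large numbers. For a centred function
`g` of the delays, the products `b t * g (ξ t)` are orthogonal with bounded second moments, so their
averages tend to zero (`ae_tendsto_average_of_orthogonal`). Hence the average of `B * b t` is that of
`p * b t`, where `p = P(B = 1)`, and summing the recursion gives the average of `b t`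
(`tendsto_average_of_recursion`). Dividing the mean area of an iteration by the mean duration gives
the time average, monotonicity of the integral filling the gaps between completions
(`isLongTermAverage_of_tendsto`).

The expectations follow from two facts. Given the availability times, the uplink delays of the `m`
selected clients are i.i.d., so `W` is independent of their order statistics
(`Block.measurePreserving_wait_uplink`). And by symmetry among the clients, the expectation of a
quantity on the event `B = 1` is `1 / n` times the expected sum over the updating clients, of whom
there are `k`, with uplink delays the first `k` order statistics (`Block.integral_ind_mul`,
`sum_earliest`).
-/

/-! ### Order statistics -/

namespace TimelyFL

section OrderStat

variable {ι κ : Type*} {s : Finset ι} {v : ι → ℝ} {i k : ℕ}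

/-- The infimum defining an order statistic is attained at one of the values. -/
theorem exists_isLeast_orderStat (h1 : 1 ≤ i) (h2 : i ≤ s.card) :
    ∃ j ∈ s, IsLeast {r : ℝ | i ≤ (s.filter (fun j => v j ≤ r)).card} (v j) := by
  classical
  have key : ∀ r : ℝ, i ≤ (s.filter (fun j => v j ≤ r)).card →
      ∃ j ∈ s, i ≤ (s.filter (fun l => v l ≤ v j)).card ∧ v j ≤ r := by
    intro r hr
    have hne : (s.filter (fun j => v j ≤ r)).Nonempty := Finset.card_pos.1 (by omega)
    obtain ⟨a, ha, hmax⟩ := Finset.exists_max_image _ v hne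
    have ha' := Finset.mem_filter.1 ha
    refine ⟨a, ha'.1, hr.trans (Finset.card_le_card fun l hl => ?_), ha'.2⟩
    exact Finset.mem_filter.2 ⟨(Finset.mem_filter.1 hl).1, hmax l hl⟩
  have hne : s.Nonempty := Finset.card_pos.1 (by omega)
  obtain ⟨top, -, htop⟩ := Finset.exists_max_image s v hne
  obtain ⟨a, ha, ha2, -⟩ := key (v top) (by rwa [Finset.filter_true_of_mem htop])
  obtain ⟨b, hb, hmin⟩ := Finset.exists_min_image
    (s.filter fun j => i ≤ (s.filter (fun l => v l ≤ v j)).card) v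
    ⟨a, Finset.mem_filter.2 ⟨ha, ha2⟩⟩
  have hb' := Finset.mem_filter.1 hb
  refine ⟨b, hb'.1, hb'.2, fun r hr => ?_⟩
  obtain ⟨d, hd, hd2, hdr⟩ := key r hr
  exact (hmin d (Finset.mem_filter.2 ⟨hd, hd2⟩)).trans hdr

theorem isLeast_orderStat (h1 : 1 ≤ i) (h2 : i ≤ s.card) :
    IsLeast {r : ℝ | i ≤ (s.filter (fun j => v j ≤ r)).card} (orderStat s v i) := by
  obtain ⟨j, -, hj⟩ := exists_isLeast_orderStat (v := v) h1 h2
  rwa [orderStat, hj.csInf_eq]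

theorem exists_orderStat_eq (h1 : 1 ≤ i) (h2 : i ≤ s.card) :
    ∃ j ∈ s, orderStat s v i = v j := by
  obtain ⟨j, hj, hl⟩ := exists_isLeast_orderStat (v := v) h1 h2
  exact ⟨j, hj, hl.csInf_eq⟩

theorem orderStat_le_iff (h1 : 1 ≤ i) (h2 : i ≤ s.card) {r : ℝ} :
    orderStat s v i ≤ r ↔ i ≤ (s.filter (fun j => v j ≤ r)).card := by
  have h := isLeast_orderStat (v := v) h1 h2
  refine ⟨fun hr => le_trans h.1 (Finset.card_le_card fun l hl => ?_), fun hr => h.2 hr⟩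
  rw [Finset.mem_filter] at hl ⊢
  exact ⟨hl.1, hl.2.trans hr⟩

theorem le_card_earliest (h1 : 1 ≤ i) (h2 : i ≤ s.card) : i ≤ (earliest s v i).card :=
  (isLeast_orderStat (v := v) h1 h2).1

/-- Without ties, exactly `i` elements are the earliest `i` ones: fewer than `i` values lie strictly
below the `i`-th order statistic. -/
theorem card_earliest (hv : Function.Injective v) (h1 : 1 ≤ i) (h2 : i ≤ s.card) :
    (earliest s v i).card = i := by
  classical
  refine le_antisymm ?_ (le_card_earliest h1 h2)
  obtain ⟨j, hj, hjv⟩ := exists_orderStat_eq (v := v) h1 h2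
  have hlt : (s.filter (fun l => v l < v j)).card < i := by
    by_contra! hcon
    have hne : (s.filter (fun l => v l < v j)).Nonempty := Finset.card_pos.1 (by omega)
    obtain ⟨a, ha, hmax⟩ := Finset.exists_max_image _ v hne
    have := (orderStat_le_iff (v := v) (r := v a) h1 h2).2
      (hcon.trans (Finset.card_le_card fun l hl => Finset.mem_filter.2
        ⟨(Finset.mem_filter.1 hl).1, hmax l hl⟩))
    exact absurd (Finset.mem_filter.1 ha).2 (by rw [← hjv]; exact not_lt.2 this)
  have hsub : earliest s v i ⊆ insert j (s.filter (fun l => v l < v j)) := by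
    intro l hl
    rw [earliest, Finset.mem_filter, hjv] at hl
    rcases hl.2.lt_or_eq with h | h
    · exact Finset.mem_insert_of_mem (Finset.mem_filter.2 ⟨hl.1, h⟩)
    · exact hv h ▸ Finset.mem_insert_self _ _
  have := (Finset.card_le_card hsub).trans (Finset.card_insert_le _ _)
  omega

/-- Without ties, the earliest `k` values are the first `k` order statistics. -/
theorem sum_earliest (hv : Function.Injective v) (h1 : 1 ≤ k) (h2 : k ≤ s.card) :
    ∑ j ∈ earliest s v k, v j = ∑ i ∈ Finset.Icc 1 k, orderStat s v i := by
  classical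
  -- the induction starts at `1` because `orderStat s v 0` is a junk value
  induction k, h1 using Nat.le_induction with
  | base =>
    obtain ⟨j, hj, hjv⟩ := exists_orderStat_eq (v := v) le_rfl h2
    obtain ⟨a, ha⟩ := Finset.card_eq_one.1 (card_earliest hv le_rfl h2)
    have hja : j ∈ earliest s v 1 := Finset.mem_filter.2 ⟨hj, hjv.ge⟩
    rw [ha, Finset.mem_singleton] at hja
    subst hja
    simp [ha, hjv]
  | succ k hk ih =>
    obtain ⟨j, hj, hjv⟩ := exists_orderStat_eq (v := v) (Nat.le_add_left 1 k) h2
    have hc0 := card_earliest hv hk (by omega : k ≤ s.card)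
    have hc1 := card_earliest hv (Nat.le_add_left 1 k) h2
    have hmono : orderStat s v k ≤ orderStat s v (k + 1) :=
      (orderStat_le_iff hk (by omega)).2
        ((Nat.le_succ k).trans (isLeast_orderStat (v := v) (Nat.le_add_left 1 k) h2).1)
    have hsub : earliest s v k ⊆ earliest s v (k + 1) := fun l hl => by
      rw [earliest, Finset.mem_filter] at hl ⊢
      exact ⟨hl.1, hl.2.trans hmono⟩
    have hnot : j ∉ earliest s v k := by
      intro hmem
      have hle := (Finset.mem_filter.1 hmem).2
      rw [← hjv] at hle
      rw [earliest, le_antisymm hle hmono] at hc1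
      rw [earliest] at hc0
      omega
    have heq : insert j (earliest s v k) = earliest s v (k + 1) := by
      refine Finset.eq_of_subset_of_card_le ?_ ?_
      · exact Finset.insert_subset (Finset.mem_filter.2 ⟨hj, hjv.ge⟩) hsub
      · rw [Finset.card_insert_of_notMem hnot, hc0, hc1]
    rw [← heq, Finset.sum_insert hnot, ih (by omega), Finset.sum_Icc_succ_top (by omega), hjv,
      add_comm]

theorem orderStat_map (e : κ ↪ ι) (t : Finset κ) :
    orderStat (t.map e) v i = orderStat t (v ∘ e) i := by
  simp only [orderStat, Finset.filter_map, Finset.card_map]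
  rfl

theorem mem_earliest_map (e : κ ↪ ι) (t : Finset κ) (j : κ) :
    e j ∈ earliest (t.map e) v i ↔ j ∈ earliest t (v ∘ e) i := by
  simp [earliest, orderStat_map]

theorem orderStat_const_add (h1 : 1 ≤ i) (h2 : i ≤ s.card) (c : ℝ) :
    orderStat s (fun j => c + v j) i = c + orderStat s v i := by
  refine eq_of_forall_ge_iff fun r => ?_
  rw [orderStat_le_iff h1 h2, ← le_sub_iff_add_le', orderStat_le_iff h1 h2]
  simp only [le_sub_iff_add_le']

theorem orderStat_pos (hv : ∀ j, 0 < v j) (h1 : 1 ≤ i) (h2 : i ≤ s.card) :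
    0 < orderStat s v i := by
  obtain ⟨j, -, hj⟩ := exists_orderStat_eq (v := v) h1 h2
  exact hj ▸ hv j

theorem abs_orderStat_le [Fintype ι] (h1 : 1 ≤ i) (h2 : i ≤ s.card) :
    |orderStat s v i| ≤ ∑ j, |v j| := by
  obtain ⟨j, -, hj⟩ := exists_orderStat_eq (v := v) h1 h2
  rw [hj]
  exact Finset.single_le_sum (f := fun j => |v j|) (fun _ _ => abs_nonneg _) (Finset.mem_univ j)

/-- Order statistics over a random subset are measurable. -/
theorem measurable_orderStat {Ω : Type*} [MeasurableSpace Ω] {S : Ω → Finset ι} [Finite ι]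
    {V : Ω → ι → ℝ} (hS : ∀ j, MeasurableSet {ω | j ∈ S ω}) (hV : ∀ j, Measurable fun ω => V ω j)
    (h1 : 1 ≤ i) (h2 : ∀ ω, i ≤ (S ω).card) :
    Measurable fun ω => orderStat (S ω) (V ω) i := by
  classical
  have := Fintype.ofFinite ι
  refine measurable_of_Iic fun r => ?_
  have hset : (fun ω => orderStat (S ω) (V ω) i) ⁻¹' Set.Iic r =
      {ω | i ≤ ∑ j, if j ∈ S ω ∧ V ω j ≤ r then 1 else 0} := by
    ext ω
    rw [Set.mem_preimage, Set.mem_Iic, orderStat_le_iff h1 (h2 ω), Set.mem_ofPred_eq,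
      ← Finset.card_filter]
    have : Finset.univ.filter (fun j => j ∈ S ω ∧ V ω j ≤ r) =
        (S ω).filter (fun j => V ω j ≤ r) := by ext; simp
    rw [this]
  rw [hset]
  refine measurableSet_le measurable_const (Finset.measurable_sum _ fun j _ => ?_)
  exact Measurable.ite ((hS j).inter (measurableSet_le (hV j) measurable_const))
    measurable_const measurable_const

end OrderStat

/-! ### The age process between completions of iterations -/

namespace Run

variable {n : ℕ} (R : Run n)

/-- The `k`-th smallest uplink delay among the selected clients of iteration `t`. -/
noncomputable def uplinkTime (t : ℕ) : ℝ := orderStat (R.selected t) (R.x t) R.k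

/-- The duration of iteration `t`, including the waiting time before it. -/
noncomputable def duration (t : ℕ) : ℝ := R.waitTime t + R.c + R.uplinkTime t

/-- The time at which the server starts waiting for iteration `t`, that is, the time of completion
of iteration `t - 1`. -/
noncomputable def readyTime (t : ℕ) : ℝ := ∑ s ∈ Finset.range t, R.duration s

/-- The age of client `j` at the time `R.readyTime t`, by recursion on `t`. -/
noncomputable def readyAge (u₀ : ℝ) (j : Fin n) : ℕ → ℝ
  | 0 => -u₀
  | t + 1 => if j ∈ R.updating t then R.uplinkTime t else readyAge u₀ j t + R.duration t

/-- A run with admissible parameters all of whose delays are positive. -/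
structure Admissible : Prop where
  one_le_k : 1 ≤ R.k
  k_le_m : R.k ≤ R.m
  m_le_n : R.m ≤ n
  c_nonneg : 0 ≤ R.c
  z_pos : ∀ t j, 0 < R.z t j
  x_pos : ∀ t j, 0 < R.x t j

variable {R}

theorem Admissible.k_le_card_selected (hR : R.Admissible) (t : ℕ) : R.k ≤ (R.selected t).card :=
  hR.k_le_m.trans (le_card_earliest (hR.one_le_k.trans hR.k_le_m) (by simpa using hR.m_le_n))

theorem Admissible.waitTime_pos (hR : R.Admissible) (t : ℕ) : 0 < R.waitTime t :=
  orderStat_pos (hR.z_pos t) (hR.one_le_k.trans hR.k_le_m) (by simpa using hR.m_le_n)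

theorem Admissible.uplinkTime_pos (hR : R.Admissible) (t : ℕ) : 0 < R.uplinkTime t :=
  orderStat_pos (hR.x_pos t) hR.one_le_k (hR.k_le_card_selected t)

theorem Admissible.duration_pos (hR : R.Admissible) (t : ℕ) : 0 < R.duration t := by
  have := hR.waitTime_pos t
  have := hR.uplinkTime_pos t
  have := hR.c_nonneg
  unfold duration
  positivity

theorem Admissible.monotone_readyTime (hR : R.Admissible) : Monotone R.readyTime :=
  monotone_nat_of_le_succ fun t => by
    rw [readyTime, readyTime, Finset.sum_range_succ]
    linarith [hR.duration_pos t]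

theorem Admissible.startTime_eq (hR : R.Admissible) (t : ℕ) :
    R.startTime t = R.readyTime t + R.waitTime t := by
  induction t with
  | zero => simp [startTime, readyTime]
  | succ t ih =>
    have : R.serviceTime t = R.c + R.uplinkTime t :=
      orderStat_const_add hR.one_le_k (hR.k_le_card_selected t) _
    rw [startTime, ih, this, readyTime, readyTime, Finset.sum_range_succ, duration]
    ring

theorem Admissible.genTime_eq (hR : R.Admissible) (t : ℕ) :
    R.genTime t = R.readyTime t + (R.waitTime t + R.c) := by
  rw [genTime, hR.startTime_eq, add_assoc]

theorem Admissible.readyTime_succ (hR : R.Admissible) (t : ℕ) :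
    R.readyTime (t + 1) = R.genTime t + R.uplinkTime t := by
  rw [hR.genTime_eq, readyTime, Finset.sum_range_succ, ← readyTime, duration]
  ring

theorem x_le_uplinkTime_of_mem {t : ℕ} {j : Fin n} (hj : j ∈ R.updating t) :
    R.x t j ≤ R.uplinkTime t := (Finset.mem_filter.1 hj).2

/-- `R.readyTime t - R.readyAge u₀ j t` is the latest generation time among the updates of client `j`
used before iteration `t`. -/
theorem Admissible.isGreatest_readyAge (hR : R.Admissible) {u₀ : ℝ} (hu : u₀ ≤ 0) (j : Fin n)
    (t : ℕ) :
    IsGreatest (insert u₀ {g | ∃ s < t, j ∈ R.updating s ∧ g = R.genTime s})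
      (R.readyTime t - R.readyAge u₀ j t) ∧ 0 ≤ R.readyAge u₀ j t := by
  induction t with
  | zero => simpa [readyTime, readyAge, IsGreatest, upperBounds] using hu
  | succ t ih =>
    obtain ⟨⟨hmem, hub⟩, hpos⟩ := ih
    have hgt := hR.genTime_eq t
    have hw := hR.waitTime_pos t
    have hc := hR.c_nonneg
    have hy := hR.uplinkTime_pos t
    by_cases hj : j ∈ R.updating t
    · simp only [readyAge, if_pos hj]
      refine ⟨?_, hy.le⟩
      rw [hR.readyTime_succ, add_sub_cancel_right]
      refine ⟨Or.inr ⟨t, Nat.lt_succ_self t, hj, rfl⟩, ?_⟩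
      have hub' : ∀ g ∈ insert u₀ {g | ∃ s < t, j ∈ R.updating s ∧ g = R.genTime s},
          g ≤ R.genTime t := fun g hg => (hub hg).trans (by linarith)
      rintro g (rfl | ⟨s, hs, hjs, rfl⟩)
      · exact hub' _ (Or.inl rfl)
      · rcases Nat.lt_succ_iff_lt_or_eq.1 hs with h | rfl
        · exact hub' _ (Or.inr ⟨s, h, hjs, rfl⟩)
        · exact le_rfl
    · simp only [readyAge, if_neg hj]
      have he : R.readyTime (t + 1) - (R.readyAge u₀ j t + R.duration t)
          = R.readyTime t - R.readyAge u₀ j t := by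
        rw [readyTime, Finset.sum_range_succ, ← readyTime]; ring
      have hset : {g | ∃ s < t + 1, j ∈ R.updating s ∧ g = R.genTime s}
          = {g | ∃ s < t, j ∈ R.updating s ∧ g = R.genTime s} := by
        ext g
        constructor
        · rintro ⟨s, hs, hjs, rfl⟩
          rcases Nat.lt_succ_iff_lt_or_eq.1 hs with h | rfl
          · exact ⟨s, h, hjs, rfl⟩
          · exact absurd hjs hj
        · rintro ⟨s, hs, h⟩
          exact ⟨s, hs.trans (Nat.lt_succ_self t), h⟩
      rw [he, hset]
      exact ⟨⟨hmem, hub⟩, add_nonneg hpos (hR.duration_pos t).le⟩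

/-- By the time `R.readyTime t` exactly the updates of the iterations before `t` have been received,
and the only update that can arrive before `R.readyTime (t + 1)` is that of iteration `t`. -/
theorem Admissible.received_iff (hR : R.Admissible) {j : Fin n} {t s : ℕ} {τ : ℝ}
    (h1 : R.readyTime t ≤ τ) (h2 : τ < R.readyTime (t + 1)) (hj : j ∈ R.updating s) :
    R.genTime s + R.x s j ≤ τ ↔ s < t ∨ s = t ∧ R.genTime t + R.x t j ≤ τ := by
  rcases lt_trichotomy s t with h | rfl | h
  · have := hR.monotone_readyTime (Nat.succ_le_of_lt h)
    have := hR.readyTime_succ s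
    have := x_le_uplinkTime_of_mem hj
    simp only [h, true_or, iff_true]
    rw [Nat.succ_eq_add_one] at *
    linarith
  · simp
  · have := hR.monotone_readyTime (Nat.succ_le_of_lt h)
    have := hR.genTime_eq s
    have := hR.waitTime_pos s
    have := hR.c_nonneg
    have := hR.x_pos s j
    have hn : ¬ (R.genTime s + R.x s j ≤ τ) := by
      rw [Nat.succ_eq_add_one] at *
      linarith
    have h' : ¬ s < t := by omega
    have h'' : s ≠ t := by omega
    simp [hn, h', h'']

theorem Admissible.age_eq_of_received (hR : R.Admissible) {u₀ : ℝ} (hu : u₀ ≤ 0) {j : Fin n}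
    {t : ℕ} {τ : ℝ} (h1 : R.readyTime t ≤ τ) (h2 : τ < R.readyTime (t + 1))
    (hj : j ∈ R.updating t) (hτ : R.genTime t + R.x t j ≤ τ) : R.age u₀ j τ = τ - R.genTime t := by
  have hg : IsGreatest (insert u₀ {g : ℝ | ∃ t : ℕ, j ∈ R.updating t ∧
      R.genTime t + R.x t j ≤ τ ∧ g = R.genTime t}) (R.genTime t) := by
    refine ⟨Or.inr ⟨t, hj, hτ, rfl⟩, ?_⟩
    obtain ⟨⟨-, hub⟩, hpos⟩ := hR.isGreatest_readyAge hu j t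
    have hle : R.readyTime t - R.readyAge u₀ j t ≤ R.genTime t := by
      have := hR.genTime_eq t
      have := hR.waitTime_pos t
      have := hR.c_nonneg
      linarith
    rintro g (rfl | ⟨s, hjs, hs, rfl⟩)
    · exact (hub (Or.inl rfl)).trans hle
    · rcases (hR.received_iff h1 h2 hjs).1 hs with h | ⟨rfl, -⟩
      · exact (hub (Or.inr ⟨s, h, hjs, rfl⟩)).trans hle
      · exact le_rfl
  rw [age, lastGenTime, hg.csSup_eq]

theorem Admissible.age_eq_of_not_received (hR : R.Admissible) {u₀ : ℝ} (hu : u₀ ≤ 0) {j : Fin n}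
    {t : ℕ} {τ : ℝ} (h1 : R.readyTime t ≤ τ) (h2 : τ < R.readyTime (t + 1))
    (hτ : j ∈ R.updating t → τ < R.genTime t + R.x t j) :
    R.age u₀ j τ = τ - R.readyTime t + R.readyAge u₀ j t := by
  have hset : {g : ℝ | ∃ t : ℕ, j ∈ R.updating t ∧ R.genTime t + R.x t j ≤ τ ∧
      g = R.genTime t} = {g | ∃ s < t, j ∈ R.updating s ∧ g = R.genTime s} := by
    ext g
    constructor
    · rintro ⟨s, hjs, hs, rfl⟩
      rcases (hR.received_iff h1 h2 hjs).1 hs with h | ⟨rfl, h⟩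
      · exact ⟨s, h, hjs, rfl⟩
      · exact absurd (hτ hjs) (not_lt.2 h)
    · rintro ⟨s, h, hjs, rfl⟩
      exact ⟨s, hjs, (hR.received_iff h1 h2 hjs).2 (Or.inl h), rfl⟩
  rw [age, lastGenTime, hset, (hR.isGreatest_readyAge hu j t).1.csSup_eq]
  ring

theorem intervalIntegral_congr_Ico {f g : ℝ → ℝ} {a b : ℝ} (hab : a ≤ b)
    (hg : Continuous g) (h : ∀ x, a ≤ x → x < b → f x = g x) :
    IntervalIntegrable f volume a b ∧ ∫ x in a..b, f x = ∫ x in a..b, g x := by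
  have hae : ∀ᵐ x ∂volume, x ∈ Set.uIoc a b → f x = g x := by
    have : ∀ᵐ x ∂(volume : Measure ℝ), x ≠ b := by simp [ae_iff]
    filter_upwards [this] with x hx hmem
    rw [Set.uIoc_of_le hab] at hmem
    exact h x hmem.1.le (lt_of_le_of_ne hmem.2 hx)
  refine ⟨?_, intervalIntegral.integral_congr_ae hae⟩
  refine (hg.intervalIntegrable a b).congr_ae ?_
  rw [EventuallyEq, ae_restrict_iff' measurableSet_uIoc]
  filter_upwards [hae] with x hx hmem
  exact (hx hmem).symm

theorem integral_sub_const_add (a b d e : ℝ) :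
    ∫ x in a..b, (x - d + e) = ((b - d + e) ^ 2 - (a - d + e) ^ 2) / 2 := by
  have : ∀ x : ℝ, x - d + e = x + (e - d) := fun x => by ring
  simp only [this]
  rw [intervalIntegral.integral_comp_add_right (fun x => x), integral_id]

/-- The area under the age of client `j` during iteration `t`. If `j` is updating, the age grows from
`R.readyAge u₀ j t` until the update of `j` is received and is the time since `R.genTime t` from
then on; otherwise it grows throughout. -/
theorem Admissible.integral_age_iteration (hR : R.Admissible) {u₀ : ℝ} (hu : u₀ ≤ 0) (j : Fin n)
    (t : ℕ) :
    IntervalIntegrable (R.age u₀ j) volume (R.readyTime t) (R.readyTime (t + 1)) ∧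
    ∫ τ in R.readyTime t..R.readyTime (t + 1), R.age u₀ j τ =
      R.duration t ^ 2 / 2 + if j ∈ R.updating t then
        R.readyAge u₀ j t * (R.waitTime t + R.c + R.x t j)
          - (R.waitTime t + R.c) * (R.uplinkTime t - R.x t j)
      else R.readyAge u₀ j t * R.duration t := by
  have hC : R.readyTime (t + 1) = R.readyTime t + R.duration t := by
    rw [readyTime, Finset.sum_range_succ, ← readyTime]
  have hg := hR.genTime_eq t
  have hw := hR.waitTime_pos t
  have hc := hR.c_nonneg
  have hy := hR.uplinkTime_pos t
  have hx := hR.x_pos t j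
  have hd := hR.duration_pos t
  by_cases hj : j ∈ R.updating t
  · have hxy := x_le_uplinkTime_of_mem hj
    have hs := hR.readyTime_succ t
    obtain ⟨i1, e1⟩ := intervalIntegral_congr_Ico (f := R.age u₀ j)
      (g := fun τ => τ - R.readyTime t + R.readyAge u₀ j t) (a := R.readyTime t)
      (b := R.genTime t + R.x t j) (by linarith) (by fun_prop)
      (fun τ h1 h2 => hR.age_eq_of_not_received hu h1 (by linarith) (fun _ => h2))
    obtain ⟨i2, e2⟩ := intervalIntegral_congr_Ico (f := R.age u₀ j)
      (g := fun τ => τ - R.genTime t + 0) (a := R.genTime t + R.x t j)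
      (b := R.readyTime (t + 1)) (by linarith) (by fun_prop)
      (fun τ h1 h2 => by rw [add_zero]; exact hR.age_eq_of_received hu (by linarith) h2 hj h1)
    refine ⟨i1.trans i2, ?_⟩
    rw [← intervalIntegral.integral_add_adjacent_intervals i1 i2, e1, e2, if_pos hj,
      integral_sub_const_add, integral_sub_const_add, hC, hg, duration]
    ring
  · obtain ⟨i1, e1⟩ := intervalIntegral_congr_Ico (f := R.age u₀ j)
      (g := fun τ => τ - R.readyTime t + R.readyAge u₀ j t) (a := R.readyTime t)
      (b := R.readyTime (t + 1)) (by linarith) (by fun_prop)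
      (fun τ h1 h2 => hR.age_eq_of_not_received hu h1 h2 (fun h => absurd h hj))
    refine ⟨i1, ?_⟩
    rw [e1, if_neg hj, integral_sub_const_add, hC]
    ring

theorem Admissible.integral_age (hR : R.Admissible) {u₀ : ℝ} (hu : u₀ ≤ 0) (j : Fin n) (N : ℕ) :
    IntervalIntegrable (R.age u₀ j) volume 0 (R.readyTime N) ∧
    ∫ τ in (0 : ℝ)..R.readyTime N, R.age u₀ j τ =
      ∑ t ∈ Finset.range N, ∫ τ in R.readyTime t..R.readyTime (t + 1), R.age u₀ j τ := by
  classical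
  have h0 : R.readyTime 0 = 0 := by simp [readyTime]
  have hi : ∀ t < N, IntervalIntegrable (R.age u₀ j) volume (R.readyTime t) (R.readyTime (t + 1)) :=
    fun t _ => (hR.integral_age_iteration hu j t).1
  rw [← h0]
  exact ⟨IntervalIntegrable.trans_iterate hi,
    (intervalIntegral.sum_integral_adjacent_intervals hi).symm⟩

theorem Admissible.age_nonneg (hR : R.Admissible) {u₀ : ℝ} (hu : u₀ ≤ 0) (j : Fin n) {τ : ℝ}
    (hτ : 0 ≤ τ) :
    0 ≤ R.age u₀ j τ := by
  rw [age, sub_nonneg, lastGenTime]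
  refine csSup_le (Set.insert_nonempty _ _) ?_
  rintro g (rfl | ⟨s, -, hs, rfl⟩)
  · exact hu.trans hτ
  · linarith [hR.x_pos s j]

end Run

/-! ### Long-term averages -/

/-- The long-term average of a nonnegative function from its integrals up to an increasing sequence
of times: a renewal-reward argument in which monotonicity of the integral bridges the gaps. -/
theorem isLongTermAverage_of_tendsto {f : ℝ → ℝ} {C : ℕ → ℝ} {A l : ℝ} (hl : 0 < l)
    (hf : ∀ τ, 0 ≤ τ → 0 ≤ f τ) (hC0 : C 0 = 0) (hC : Monotone C)
    (hint : ∀ N, IntervalIntegrable f volume 0 (C N))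
    (hCl : Tendsto (fun N : ℕ => C N / N) atTop (𝓝 l))
    (hA : Tendsto (fun N : ℕ => (∫ τ in (0 : ℝ)..C N, f τ) / N) atTop (𝓝 A)) :
    IsLongTermAverage f (A / l) := by
  have hCtop : Tendsto C atTop atTop := by
    have := hCl.pos_mul_atTop hl tendsto_natCast_atTop_atTop
    refine this.congr' ?_
    filter_upwards [eventually_gt_atTop 0] with N hN
    field_simp
  have hlt : ∀ T : ℝ, ∃ N, T < C (N + 1) := fun T =>
    (((tendsto_add_atTop_iff_nat 1).2 hCtop).eventually_gt_atTop T).exists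
  have hI : ∀ T : ℝ, 0 ≤ T → IntervalIntegrable f volume 0 T := by
    intro T hT
    obtain ⟨N, hN⟩ := hlt T
    refine (hint (N + 1)).mono_set ?_
    rw [Set.uIcc_of_le hT, Set.uIcc_of_le (hT.trans hN.le)]
    exact Set.Icc_subset_Icc_right hN.le
  refine ⟨hI, ?_⟩
  set F : ℝ → ℝ := fun T => ∫ τ in (0 : ℝ)..T, f τ with hF
  have hmono : ∀ a b, 0 ≤ a → a ≤ b → F a ≤ F b := by
    intro a b ha hab
    have h1 := intervalIntegral.integral_interval_sub_left (hI b (ha.trans hab)) (hI a ha)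
    have h2 : 0 ≤ ∫ τ in a..b, f τ :=
      intervalIntegral.integral_nonneg hab fun u hu => hf u (ha.trans hu.1)
    simp only [hF]
    linarith
  have hC_nonneg : ∀ N, 0 ≤ C N := fun N => hC0 ▸ hC (Nat.zero_le N)
  have hF_nonneg : ∀ a, 0 ≤ a → 0 ≤ F a := fun a ha => by
    simpa [hF] using hmono 0 a le_rfl ha
  classical
  -- the number of iterations completed by time `T`
  set ν : ℝ → ℕ := fun T => Nat.find (hlt T) with hν
  have hν1 : ∀ T, T < C (ν T + 1) := fun T => Nat.find_spec (hlt T)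
  have hν2 : ∀ T, 0 ≤ T → C (ν T) ≤ T := by
    intro T hT
    rcases Nat.eq_zero_or_pos (ν T) with h | h
    · rw [h, hC0]; exact hT
    · have := Nat.find_min (hlt T) (m := ν T - 1) (by simp only [hν] at h ⊢; omega)
      rw [Nat.sub_add_cancel h] at this
      exact not_lt.1 this
  have hνtop : Tendsto ν atTop atTop := by
    refine tendsto_atTop.2 fun K => ?_
    filter_upwards [eventually_ge_atTop (C K)] with T hT
    by_contra! hcon
    have h1 := hC (Nat.succ_le_of_lt hcon)
    have h2 := hν1 T
    rw [Nat.succ_eq_add_one] at h1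
    linarith
  have hsucc : Tendsto (fun N : ℕ => ((N + 1 : ℕ) : ℝ) / N) atTop (𝓝 1) := by
    have h : Tendsto (fun N : ℕ => 1 + 1 / (N : ℝ)) atTop (𝓝 (1 + 0)) :=
      tendsto_const_nhds.add tendsto_one_div_atTop_nhds_zero_nat
    rw [add_zero] at h
    refine h.congr' ?_
    filter_upwards [eventually_gt_atTop 0] with N hN
    push_cast
    field_simp
  have hshift : ∀ (u : ℕ → ℝ) (a : ℝ), Tendsto (fun N : ℕ => u N / N) atTop (𝓝 a) →
      Tendsto (fun N : ℕ => u (N + 1) / N) atTop (𝓝 a) := by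
    intro u a hu
    have h := ((tendsto_add_atTop_iff_nat 1).2 hu).mul hsucc
    rw [mul_one] at h
    refine h.congr' ?_
    filter_upwards [eventually_gt_atTop 0] with N hN
    have : ((N + 1 : ℕ) : ℝ) ≠ 0 := by positivity
    field_simp
  have hlow : Tendsto (fun T => F (C (ν T)) / ν T / (C (ν T + 1) / ν T)) atTop (𝓝 (A / l)) :=
    (hA.div (hshift C l hCl) hl.ne').comp hνtop
  have hup : Tendsto (fun T => F (C (ν T + 1)) / ν T / (C (ν T) / ν T)) atTop (𝓝 (A / l)) :=
    ((hshift (fun N => F (C N)) A hA).div hCl hl.ne').comp hνtop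
  refine tendsto_of_tendsto_of_tendsto_of_le_of_le' hlow hup ?_ ?_
  · filter_upwards [eventually_gt_atTop 0, hνtop.eventually_gt_atTop 0] with T hT hN
    have hN' : (ν T : ℝ) ≠ 0 := by positivity
    rw [div_div_div_cancel_right₀ hN', one_div_mul_eq_div]
    exact div_le_div₀ (hF_nonneg T hT.le) (hmono _ _ (hC_nonneg _) (hν2 T hT.le)) hT (hν1 T).le
  · filter_upwards [eventually_gt_atTop 0, hνtop.eventually_gt_atTop 0,
      (hCtop.comp hνtop).eventually_gt_atTop 0] with T hT hN hpos
    have hN' : (ν T : ℝ) ≠ 0 := by positivity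
    rw [div_div_div_cancel_right₀ hN', one_div_mul_eq_div]
    exact div_le_div₀ (hF_nonneg _ (hC_nonneg _)) (hmono _ _ hT.le (hν1 T).le) hpos (hν2 T hT.le)

/-- Averages along the affine recursion `b (t + 1) = (1 - B t) * b t + U t`: summing the recursion
determines the average of `B t * b t`, hence that of `b t`. -/
theorem tendsto_average_of_recursion {b B U V Q : ℕ → ℝ} {p u v q : ℝ} (hp : p ≠ 0)
    (hrec : ∀ t, b (t + 1) = (1 - B t) * b t + U t)
    (hU : Tendsto (fun N : ℕ => (∑ t ∈ Finset.range N, U t) / N) atTop (𝓝 u))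
    (hQ : Tendsto (fun N : ℕ => (∑ t ∈ Finset.range N, Q t) / N) atTop (𝓝 q))
    (hB : Tendsto (fun N : ℕ => (∑ t ∈ Finset.range N, b t * (B t - p)) / N) atTop (𝓝 0))
    (hV : Tendsto (fun N : ℕ => (∑ t ∈ Finset.range N, b t * (V t - v)) / N) atTop (𝓝 0))
    (hb : Tendsto (fun N : ℕ => b N / N) atTop (𝓝 0)) :
    Tendsto (fun N : ℕ => (∑ t ∈ Finset.range N, (Q t + b t * V t)) / N) atTop
      (𝓝 (q + v * (u / p))) := by
  have hsum : ∀ N, ∑ t ∈ Finset.range N, b t =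
      (∑ t ∈ Finset.range N, U t - ∑ t ∈ Finset.range N, b t * (B t - p) - b N + b 0) / p := by
    intro N
    induction N with
    | zero => simp
    | succ N ih =>
      rw [eq_div_iff hp] at ih ⊢
      rw [Finset.sum_range_succ, Finset.sum_range_succ, Finset.sum_range_succ, hrec, add_mul, ih]
      ring
  have h0 : Tendsto (fun N : ℕ => b 0 / N) atTop (𝓝 0) := tendsto_const_div_atTop_nhds_zero_nat _
  have hbavg := ((((hU.sub hB).sub hb).add h0).div_const p).const_mul v
  have := (hQ.add hV).add hbavg
  simp only [sub_zero, add_zero] at this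
  refine this.congr fun N => ?_
  have : ∑ t ∈ Finset.range N, (Q t + b t * V t) = ∑ t ∈ Finset.range N, Q t +
      ∑ t ∈ Finset.range N, b t * (V t - v) + v * ∑ t ∈ Finset.range N, b t := by
    rw [Finset.mul_sum, ← Finset.sum_add_distrib, ← Finset.sum_add_distrib]
    exact Finset.sum_congr rfl fun t _ => by ring
  rw [this, hsum]
  ring

/-! ### A strong law for orthogonal random variables -/

section Orthogonal

variable {Ω : Type*} [MeasurableSpace Ω] {P : Measure Ω}

/-- Chebyshev's inequality and the Borel-Cantelli lemma, in the form that the squares are almost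
surely summable. -/
theorem ae_tendsto_zero_of_integral_sq_le {g : ℕ → Ω → ℝ} {K : ℝ} (hg : ∀ i, MemLp (g i) 2 P)
    (hK : ∀ i : ℕ, ∫ ω, g i ω ^ 2 ∂P ≤ K / (i : ℝ) ^ 2) :
    ∀ᵐ ω ∂P, Tendsto (fun i => g i ω) atTop (𝓝 0) := by
  have hmeas : ∀ i, AEMeasurable (fun ω => ENNReal.ofReal (g i ω ^ 2)) P := fun i =>
    ((hg i).aestronglyMeasurable.aemeasurable.pow_const 2).ennreal_ofReal
  have hfin : ∫⁻ ω, ∑' i, ENNReal.ofReal (g i ω ^ 2) ∂P ≠ ⊤ := by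
    rw [lintegral_tsum hmeas]
    have hsumm : Summable fun i : ℕ => K / (i : ℝ) ^ 2 := by
      simpa [div_eq_mul_one_div K] using
        (Real.summable_one_div_nat_pow.2 one_lt_two).mul_left K
    have hle : ∀ i, ∫⁻ ω, ENNReal.ofReal (g i ω ^ 2) ∂P ≤ ENNReal.ofReal (K / (i : ℝ) ^ 2) := by
      intro i
      rw [← ofReal_integral_eq_lintegral_ofReal (hg i).integrable_sq
        (ae_of_all _ fun ω => sq_nonneg _)]
      exact ENNReal.ofReal_le_ofReal (hK i)
    exact ne_top_of_le_ne_top hsumm.tsum_ofReal_ne_top (ENNReal.tsum_le_tsum hle)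
  filter_upwards [ae_lt_top' (AEMeasurable.tsum hmeas) hfin] with ω hω
  have h1 := ENNReal.tendsto_atTop_zero_of_tsum_ne_top hω.ne
  have h2 := (ENNReal.tendsto_toReal ENNReal.zero_ne_top).comp h1
  have h3 : Tendsto (fun i => g i ω ^ 2) atTop (𝓝 0) := by
    refine h2.congr fun i => ?_
    simp [ENNReal.toReal_ofReal (sq_nonneg (g i ω))]
  have h4 := h3.sqrt
  simp only [Real.sqrt_sq_eq_abs, Real.sqrt_zero] at h4
  exact (tendsto_zero_iff_abs_tendsto_zero _).2 h4

theorem ae_tendsto_div_of_integral_sq_le {g : ℕ → Ω → ℝ} {K : ℝ} (hg : ∀ i, MemLp (g i) 2 P)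
    (hK : ∀ i : ℕ, ∫ ω, g i ω ^ 2 ∂P ≤ K) :
    ∀ᵐ ω ∂P, Tendsto (fun i : ℕ => g i ω / i) atTop (𝓝 0) := by
  refine ae_tendsto_zero_of_integral_sq_le (K := K) (fun i => ?_) fun i => ?_
  · simpa only [div_eq_mul_inv] using (hg i).mul_const _
  · simp only [div_pow, integral_div]
    gcongr
    exact hK i

theorem integral_sq_sum_of_orthogonal {d : ℕ → Ω → ℝ} (hd : ∀ t, MemLp (d t) 2 P)
    (horth : ∀ s t, s < t → ∫ ω, d s ω * d t ω ∂P = 0) (N : ℕ) :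
    ∫ ω, (∑ t ∈ Finset.range N, d t ω) ^ 2 ∂P = ∑ t ∈ Finset.range N, ∫ ω, d t ω ^ 2 ∂P := by
  induction N with
  | zero => simp
  | succ N ih =>
    have hS : MemLp (fun ω => ∑ t ∈ Finset.range N, d t ω) 2 P := memLp_finsetSum _ fun t _ => hd t
    have hcross : ∫ ω, (∑ t ∈ Finset.range N, d t ω) * d N ω ∂P = 0 := by
      simp only [Finset.sum_mul]
      have hi : ∀ t, Integrable (fun ω => d t ω * d N ω) P := fun t =>
        (hd t).integrable_mul (hd N)
      rw [integral_finsetSum _ fun t _ => hi t]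
      exact Finset.sum_eq_zero fun t ht => horth t N (Finset.mem_range.1 ht)
    have hexp : ∀ ω, (∑ t ∈ Finset.range (N + 1), d t ω) ^ 2 =
        ((∑ t ∈ Finset.range N, d t ω) ^ 2 + 2 * ((∑ t ∈ Finset.range N, d t ω) * d N ω))
          + d N ω ^ 2 := fun ω => by
      rw [Finset.sum_range_succ]; ring
    have hi : Integrable (fun ω => 2 * ((∑ t ∈ Finset.range N, d t ω) * d N ω)) P :=
      (hS.integrable_mul (hd N)).const_mul 2
    have hi' : Integrable (fun ω => (∑ t ∈ Finset.range N, d t ω) ^ 2 +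
        2 * ((∑ t ∈ Finset.range N, d t ω) * d N ω)) P := hS.integrable_sq.add hi
    simp only [hexp]
    rw [integral_add hi' (hd N).integrable_sq,
      integral_add hS.integrable_sq hi, integral_const_mul, hcross, ih, Finset.sum_range_succ]
    ring

/-- The strong law of large numbers for orthogonal random variables with bounded second moments.
The averages converge along the squares by Chebyshev's inequality, and the second moments of
`∑ |d t|` over the gaps between consecutive squares are small enough as well. -/
theorem ae_tendsto_average_of_orthogonal {d : ℕ → Ω → ℝ} {K : ℝ} (hd : ∀ t, MemLp (d t) 2 P)
    (horth : ∀ s t, s < t → ∫ ω, d s ω * d t ω ∂P = 0) (hK : ∀ t, ∫ ω, d t ω ^ 2 ∂P ≤ K) :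
    ∀ᵐ ω ∂P, Tendsto (fun N : ℕ => (∑ t ∈ Finset.range N, d t ω) / N) atTop (𝓝 0) := by
  have hK0 : 0 ≤ K := (integral_nonneg fun ω => sq_nonneg _).trans (hK 0)
  have hsq : ∀ᵐ ω ∂P, Tendsto (fun i : ℕ => (∑ t ∈ Finset.range (i ^ 2), d t ω) / (i : ℝ) ^ 2)
      atTop (𝓝 0) := by
    refine ae_tendsto_zero_of_integral_sq_le (K := K) (fun i => ?_) fun i => ?_
    · simpa only [div_eq_mul_inv] using (memLp_finsetSum _ fun t _ => hd t).mul_const _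
    · simp only [div_pow, integral_div]
      rw [integral_sq_sum_of_orthogonal hd horth]
      rcases Nat.eq_zero_or_pos i with rfl | hi
      · simp
      · have h1 : ∑ t ∈ Finset.range (i ^ 2), ∫ ω, d t ω ^ 2 ∂P ≤ (i : ℝ) ^ 2 * K := by
          refine (Finset.sum_le_card_nsmul _ _ K fun t _ => hK t).trans ?_
          simp
        rw [div_le_div_iff₀ (by positivity) (by positivity)]
        calc _ ≤ ((i : ℝ) ^ 2 * K) * (i : ℝ) ^ 2 := by gcongr
          _ = _ := by ring
  have hgap : ∀ᵐ ω ∂P, Tendsto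
      (fun i : ℕ => (∑ t ∈ Finset.Ico (i ^ 2) ((i + 1) ^ 2), |d t ω|) / (i : ℝ) ^ 2)
      atTop (𝓝 0) := by
    refine ae_tendsto_zero_of_integral_sq_le (K := 9 * K) (fun i => ?_) fun i => ?_
    · have habs : ∀ t, MemLp (fun ω => |d t ω|) 2 P := fun t => (hd t).abs
      simpa only [div_eq_mul_inv] using (memLp_finsetSum _ fun t _ => habs t).mul_const _
    · simp only [div_pow, integral_div]
      rcases Nat.eq_zero_or_pos i with rfl | hi
      · simp
      · -- the gap has `2 * i + 1 ≤ 3 * i` elements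
        have hcard : ((Finset.Ico (i ^ 2) ((i + 1) ^ 2)).card : ℝ) ≤ 3 * i := by
          have : (Finset.Ico (i ^ 2) ((i + 1) ^ 2)).card ≤ 3 * i := by
            rw [Nat.card_Ico, Nat.sub_le_iff_le_add]
            nlinarith
          exact_mod_cast this
        have hI : Integrable (fun ω => ∑ t ∈ Finset.Ico (i ^ 2) ((i + 1) ^ 2), d t ω ^ 2) P :=
          integrable_finsetSum _ fun t _ => (hd t).integrable_sq
        have h1 : ∫ ω, (∑ t ∈ Finset.Ico (i ^ 2) ((i + 1) ^ 2), |d t ω|) ^ 2 ∂P ≤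
            3 * i * (3 * i * K) := by
          calc _ ≤ ∫ ω, ((Finset.Ico (i ^ 2) ((i + 1) ^ 2)).card : ℝ) *
                  ∑ t ∈ Finset.Ico (i ^ 2) ((i + 1) ^ 2), d t ω ^ 2 ∂P := by
                refine integral_mono_of_nonneg (ae_of_all _ fun ω => sq_nonneg _)
                  (hI.const_mul _) (ae_of_all _ fun ω => ?_)
                simpa using sq_sum_le_card_mul_sum_sq
                  (s := Finset.Ico (i ^ 2) ((i + 1) ^ 2)) (f := fun t => |d t ω|)
            _ = (Finset.Ico (i ^ 2) ((i + 1) ^ 2)).card *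
                  ∑ t ∈ Finset.Ico (i ^ 2) ((i + 1) ^ 2), ∫ ω, d t ω ^ 2 ∂P := by
                rw [integral_const_mul, integral_finsetSum _ fun t _ => (hd t).integrable_sq]
            _ ≤ (Finset.Ico (i ^ 2) ((i + 1) ^ 2)).card *
                  ((Finset.Ico (i ^ 2) ((i + 1) ^ 2)).card * K) := by
                gcongr
                simpa using Finset.sum_le_card_nsmul (Finset.Ico (i ^ 2) ((i + 1) ^ 2))
                  (fun t => ∫ ω, d t ω ^ 2 ∂P) K fun t _ => hK t
            _ ≤ _ := by gcongr
        rw [div_le_div_iff₀ (by positivity) (by positivity)]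
        calc _ ≤ (3 * i * (3 * i * K)) * (i : ℝ) ^ 2 := by gcongr
          _ = _ := by ring
  filter_upwards [hsq, hgap] with ω h1 h2
  have hsqrt : Tendsto Nat.sqrt atTop atTop := by
    refine tendsto_atTop.2 fun a => ?_
    filter_upwards [eventually_ge_atTop (a ^ 2)] with N hN
    exact Nat.le_sqrt'.2 hN
  have hbound := (h1.abs.add h2).comp hsqrt
  simp only [abs_zero, add_zero] at hbound
  refine squeeze_zero_norm' ?_ hbound
  filter_upwards [eventually_gt_atTop 0] with N hN
  set i := Nat.sqrt N with hi
  have hi0 : 0 < i := Nat.sqrt_pos.2 hN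
  have hiN : i ^ 2 ≤ N := Nat.sqrt_le' N
  have hiN' : N < (i + 1) ^ 2 := Nat.lt_succ_sqrt' N
  have hiR : (i : ℝ) ^ 2 ≤ N := by exact_mod_cast hiN
  have hsplit : ∑ t ∈ Finset.range N, d t ω =
      ∑ t ∈ Finset.range (i ^ 2), d t ω + ∑ t ∈ Finset.Ico (i ^ 2) N, d t ω :=
    (Finset.sum_range_add_sum_Ico _ hiN).symm
  have hle : |∑ t ∈ Finset.range N, d t ω| ≤ |∑ t ∈ Finset.range (i ^ 2), d t ω| +
      ∑ t ∈ Finset.Ico (i ^ 2) ((i + 1) ^ 2), |d t ω| := by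
    rw [hsplit]
    refine (abs_add_le _ _).trans (add_le_add le_rfl ((Finset.abs_sum_le_sum_abs _ _).trans ?_))
    exact Finset.sum_le_sum_of_subset_of_nonneg (Finset.Ico_subset_Ico_right hiN'.le)
      fun _ _ _ => abs_nonneg _
  have hi2 : (0 : ℝ) < (i : ℝ) ^ 2 := by positivity
  simp only [Function.comp_apply, Real.norm_eq_abs, ← hi]
  rw [abs_div, abs_div, abs_of_pos hi2, ← add_div, abs_of_nonneg (Nat.cast_nonneg (α := ℝ) N)]
  exact div_le_div₀ (by positivity) hle hi2 hiR

end Orthogonal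

/-! ### Exponential random variables -/

section Exponential

variable {r : ℝ}

theorem measurable_gammaPDF_one : Measurable (gammaPDF 1 r) :=
  (measurable_gammaPDFReal 1 r).ennreal_ofReal

theorem expMeasure_singleton (x : ℝ) : expMeasure r {x} = 0 :=
  withDensity_absolutelyContinuous volume (gammaPDF 1 r) (measure_singleton x)

theorem ae_pos_expMeasure : ∀ᵐ x ∂expMeasure r, 0 < x := by
  have h : ∀ᵐ x : ℝ, x ≠ 0 := by simp [ae_iff]
  rw [expMeasure, gammaMeasure, ae_withDensity_iff measurable_gammaPDF_one]
  filter_upwards [h] with x hx hpdf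
  by_contra hcon
  exact hpdf (gammaPDF_of_neg (lt_of_le_of_ne (not_lt.1 hcon) hx))

theorem integrable_exp_mul_expMeasure (hr : 0 < r) {t : ℝ} (ht : t < r) :
    Integrable (fun x => Real.exp (t * x)) (expMeasure r) := by
  rw [expMeasure, gammaMeasure, integrable_withDensity_iff_integrable_smul'
    measurable_gammaPDF_one (ae_of_all _ fun x => ENNReal.ofReal_lt_top)]
  have h : IntegrableOn (fun x => r * Real.exp ((t - r) * x)) (Set.Ici 0) := by
    rw [integrableOn_Ici_iff_integrableOn_Ioi]
    exact (integrableOn_exp_mul_Ioi (by linarith) 0).const_mul r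
  rw [← integrable_indicator_iff measurableSet_Ici] at h
  refine h.congr (ae_of_all _ fun x => ?_)
  beta_reduce
  by_cases hx : 0 ≤ x
  · have hpdf : gammaPDF 1 r x = ENNReal.ofReal (r * Real.exp (-(r * x))) :=
      exponentialPDF_of_nonneg hx
    rw [Set.indicator_of_mem (Set.mem_Ici.2 hx), hpdf,
      ENNReal.toReal_ofReal (by positivity), smul_eq_mul, mul_assoc, ← Real.exp_add]
    ring_nf
  · rw [Set.indicator_of_notMem (by simpa using hx), gammaPDF_of_neg (not_le.1 hx)]
    simp

theorem memLp_id_expMeasure (hr : 0 < r) : MemLp (fun x => x) 2 (expMeasure r) := by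
  refine memLp_of_mem_interior_integrableExpSet (X := fun x : ℝ => x) ?_ 2
  refine mem_interior.2 ⟨Set.Iio r, fun t ht => ?_, isOpen_Iio, hr⟩
  exact integrable_exp_mul_expMeasure hr ht

end Exponential

/-! ### Families of independent exponential random variables -/

section IidExp

variable {r : ℝ} {N M : ℕ}

theorem isProbabilityMeasure_iidExp (hr : 0 < r) : IsProbabilityMeasure (iidExp r N) := by
  have := isProbabilityMeasure_expMeasure hr
  unfold iidExp
  infer_instance

theorem measurePreserving_eval_iidExp (hr : 0 < r) (j : Fin N) :
    MeasurePreserving (fun v : Fin N → ℝ => v j) (iidExp r N) (expMeasure r) := by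
  have := isProbabilityMeasure_expMeasure hr
  exact measurePreserving_eval (fun _ : Fin N => expMeasure r) j

theorem iIndepFun_iidExp (hr : 0 < r) :
    iIndepFun (fun (j : Fin N) (v : Fin N → ℝ) => v j) (iidExp r N) := by
  have := isProbabilityMeasure_expMeasure hr
  exact iIndepFun_pi (μ := fun _ : Fin N => expMeasure r) (X := fun _ x => x)
    (fun _ => aemeasurable_id)

/-- Restricting an i.i.d. family along an injection gives an i.i.d. family; this covers subfamilies as
well as permutations. -/
theorem measurePreserving_comp_iidExp (hr : 0 < r) {e : Fin M → Fin N}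
    (he : Function.Injective e) :
    MeasurePreserving (fun v : Fin N → ℝ => v ∘ e) (iidExp r N) (iidExp r M) := by
  have hm : Measurable fun v : Fin N → ℝ => v ∘ e :=
    measurable_pi_lambda _ fun i => measurable_pi_apply (e i)
  refine ⟨hm, ?_⟩
  have := isProbabilityMeasure_iidExp (N := N) hr
  have h := (iIndepFun_iff_map_fun_eq_pi_map
    (fun i => (measurable_pi_apply (e i)).aemeasurable)).1
    ((iIndepFun_iidExp (N := N) hr).precomp he)
  refine h.trans ?_
  simp only [(measurePreserving_eval_iidExp hr _).map_eq]
  rfl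

theorem ae_pos_iidExp (hr : 0 < r) : ∀ᵐ v ∂iidExp r N, ∀ j, 0 < v j :=
  ae_all_iff.2 fun j => (measurePreserving_eval_iidExp hr j).quasiMeasurePreserving.ae
    ae_pos_expMeasure

theorem ae_injective_iidExp (hr : 0 < r) :
    ∀ᵐ v ∂iidExp r N, Function.Injective v := by
  have := isProbabilityMeasure_expMeasure hr
  have := isProbabilityMeasure_iidExp (N := N) hr
  have h : ∀ i j : Fin N, i ≠ j → ∀ᵐ v ∂iidExp r N, v i ≠ v j := by
    intro i j hij
    have hmap := ((iIndepFun_iidExp (N := N) hr).indepFun hij).map_prod_eq_prod_map_map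
      (measurable_pi_apply i).aemeasurable (measurable_pi_apply j).aemeasurable
    rw [(measurePreserving_eval_iidExp hr i).map_eq,
      (measurePreserving_eval_iidExp hr j).map_eq] at hmap
    have hdiag : ∀ᵐ q ∂(expMeasure r).prod (expMeasure r), q.1 ≠ q.2 := by
      have hms : MeasurableSet {q : ℝ × ℝ | q.1 ≠ q.2} :=
        (measurableSet_eq_fun measurable_fst measurable_snd).compl
      refine (Measure.ae_prod_iff_ae_ae hms).2 (ae_of_all _ fun x => ?_)
      have : {a : ℝ | ¬ x ≠ a} = {x} := by ext; simp [eq_comm]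
      rw [ae_iff, this, expMeasure_singleton]
    rw [← hmap] at hdiag
    have hm : Measurable fun v : Fin N → ℝ => (v i, v j) := by fun_prop
    exact ae_of_ae_map hm.aemeasurable hdiag
  have h' : ∀ᵐ v ∂iidExp r N, ∀ i j : Fin N, i ≠ j → v i ≠ v j := by
    simp only [ae_all_iff]
    exact h
  filter_upwards [h'] with v hv i j hij
  by_contra hne
  exact hv i j hne hij

theorem memLp_eval_iidExp (hr : 0 < r) (j : Fin N) :
    MemLp (fun v : Fin N → ℝ => v j) 2 (iidExp r N) :=
  (memLp_id_expMeasure hr).comp_measurePreserving (measurePreserving_eval_iidExp hr j)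

theorem measurable_os {i : ℕ} (h1 : 1 ≤ i) (h2 : i ≤ N) : Measurable (os N i) :=
  measurable_orderStat (S := fun _ => Finset.univ) (V := fun v => v)
    (fun _ => by simp) (fun j => measurable_pi_apply j) h1 (by simpa using h2)

theorem memLp_os (hr : 0 < r) {i : ℕ} (h1 : 1 ≤ i) (h2 : i ≤ N) :
    MemLp (os N i) 2 (iidExp r N) := by
  have habs : ∀ j : Fin N, MemLp (fun v : Fin N → ℝ => |v j|) 2 (iidExp r N) := fun j =>
    (memLp_eval_iidExp hr j).abs
  refine (memLp_finsetSum Finset.univ fun j _ => habs j).mono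
    (measurable_os h1 h2).aestronglyMeasurable (ae_of_all _ fun v => ?_)
  exact (abs_orderStat_le h1 (by simpa using h2)).trans (le_abs_self _)

theorem meanOS_pos (hr : 0 < r) {i : ℕ} (h1 : 1 ≤ i) (h2 : i ≤ N) : 0 < meanOS r N i := by
  have := isProbabilityMeasure_iidExp (N := N) hr
  have hpos : ∀ᵐ v ∂iidExp r N, 0 < os N i v := by
    filter_upwards [ae_pos_iidExp hr] with v hv
    exact orderStat_pos hv h1 (by simpa using h2)
  rw [meanOS, integral_pos_iff_support_of_nonneg_ae (hpos.mono fun v hv => hv.le)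
    ((memLp_os hr h1 h2).integrable one_le_two)]
  have : Function.support (os N i) =ᵐ[iidExp r N] Set.univ :=
    eventuallyEq_univ.2 (hpos.mono fun v hv => hv.ne')
  simp [measure_congr this]

end IidExp

/-! ### The joint law of the quantities of one iteration -/

section Block

/-- The delays of one iteration: availability times and uplink delays of all clients. -/
abbrev Block (n : ℕ) := (Fin n → ℝ) × (Fin n → ℝ)

namespace Block

variable {n : ℕ}

/-- The waiting time of an iteration as a function of its delays. -/
noncomputable def wait (m : ℕ) (q : Block n) : ℝ := orderStat Finset.univ q.1 m

/-- The selected clients of an iteration as a function of its delays. -/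
noncomputable def sel (m : ℕ) (q : Block n) : Finset (Fin n) := earliest Finset.univ q.1 m

/-- The `i`-th smallest uplink delay among the selected clients. -/
noncomputable def uplink (m i : ℕ) (q : Block n) : ℝ := orderStat (sel m q) q.2 i

/-- The updating clients of an iteration as a function of its delays. -/
noncomputable def upd (m k : ℕ) (q : Block n) : Finset (Fin n) := earliest (sel m q) q.2 k

/-- The indicator of the event that client `j` is updating. -/
noncomputable def ind (m k : ℕ) (j : Fin n) (q : Block n) : ℝ := if j ∈ upd m k q then 1 else 0

/-- The law of the delays of one iteration. -/
noncomputable def law (lam mu : ℝ) (n : ℕ) : Measure (Block n) :=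
  (iidExp lam n).prod (iidExp mu n)

variable {m k i : ℕ} {lam mu : ℝ}

theorem le_card_sel (h1 : 1 ≤ i) (him : i ≤ m) (hmn : m ≤ n) (q : Block n) :
    i ≤ (sel m q).card :=
  him.trans (le_card_earliest (h1.trans him) (by simpa using hmn))

theorem measurable_wait (h1 : 1 ≤ m) (hmn : m ≤ n) : Measurable (wait (n := n) m) :=
  (measurable_os h1 hmn).comp measurable_fst

theorem measurableSet_mem_sel (h1 : 1 ≤ m) (hmn : m ≤ n) (j : Fin n) :
    MeasurableSet {q : Block n | j ∈ sel m q} := by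
  have : {q : Block n | j ∈ sel m q} = {q | q.1 j ≤ wait m q} := by
    ext q; simp [sel, earliest, wait]
  rw [this]
  exact measurableSet_le (by fun_prop) (measurable_wait h1 hmn)

theorem measurable_uplink (h1 : 1 ≤ i) (him : i ≤ m) (hmn : m ≤ n) :
    Measurable (uplink (n := n) m i) :=
  measurable_orderStat (V := fun q : Block n => q.2) (measurableSet_mem_sel (h1.trans him) hmn)
    (by fun_prop) h1 (le_card_sel h1 him hmn)

theorem measurableSet_mem_upd (h1 : 1 ≤ k) (hkm : k ≤ m) (hmn : m ≤ n) (j : Fin n) :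
    MeasurableSet {q : Block n | j ∈ upd m k q} := by
  have : {q : Block n | j ∈ upd m k q} = {q | j ∈ sel m q} ∩ {q | q.2 j ≤ uplink m k q} := by
    ext q; simp [upd, earliest, uplink]
  rw [this]
  exact (measurableSet_mem_sel (h1.trans hkm) hmn j).inter
    (measurableSet_le (by fun_prop) (measurable_uplink h1 hkm hmn))

theorem measurable_ind (h1 : 1 ≤ k) (hkm : k ≤ m) (hmn : m ≤ n) (j : Fin n) :
    Measurable (ind m k j) :=
  Measurable.ite (measurableSet_mem_upd h1 hkm hmn j) measurable_const measurable_const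

theorem abs_ind_le (j : Fin n) (q : Block n) : |ind m k j q| ≤ 1 := by
  unfold ind; split_ifs <;> simp

theorem sum_ind_mul (f : Fin n → ℝ) (q : Block n) :
    ∑ j, ind m k j q * f j = ∑ j ∈ upd m k q, f j := by
  simp [ind]

theorem isProbabilityMeasure_law (hlam : 0 < lam) (hmu : 0 < mu) :
    IsProbabilityMeasure (law lam mu n) := by
  have := isProbabilityMeasure_iidExp (N := n) hlam
  have := isProbabilityMeasure_iidExp (N := n) hmu
  unfold law
  infer_instance

theorem measurePreserving_fst_law (hmu : 0 < mu) :
    MeasurePreserving Prod.fst (law lam mu n) (iidExp lam n) := by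
  have := isProbabilityMeasure_iidExp (N := n) hmu
  exact measurePreserving_fst

theorem measurePreserving_snd_law (hlam : 0 < lam) (hmu : 0 < mu) :
    MeasurePreserving Prod.snd (law lam mu n) (iidExp mu n) := by
  have := isProbabilityMeasure_iidExp (N := n) hlam
  have := isProbabilityMeasure_iidExp (N := n) hmu
  exact measurePreserving_snd

/-- The waiting time is independent of the order statistics of the uplink delays of the selected
clients, whose law does not depend on which `m` clients are selected. -/
theorem measurePreserving_wait_uplink (hlam : 0 < lam) (hmu : 0 < mu) (h1 : 1 ≤ i) (him : i ≤ m)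
    (hmn : m ≤ n) :
    MeasurePreserving (fun q : Block n => (wait m q, uplink m i q)) (law lam mu n)
      (((iidExp lam n).map (os n m)).prod ((iidExp mu m).map (os m i))) := by
  have := isProbabilityMeasure_iidExp (N := n) hlam
  have := isProbabilityMeasure_iidExp (N := n) hmu
  have hW : MeasurePreserving (os n m) (iidExp lam n) ((iidExp lam n).map (os n m)) :=
    (measurable_os (h1.trans him) hmn).measurePreserving _
  have := (Measure.isProbabilityMeasure_map (μ := iidExp lam n)
    (measurable_os (h1.trans him) hmn).aemeasurable)
  refine hW.skew_product (g := fun z x => uplink m i (z, x)) (measurable_uplink h1 him hmn) ?_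
  filter_upwards [ae_injective_iidExp hlam] with z hz
  have hcard : (earliest Finset.univ z m).card = m :=
    card_earliest hz (h1.trans him) (by simpa using hmn)
  set e := (earliest Finset.univ z m).orderEmbOfFin hcard
  have hmap : Finset.univ.map e.toEmbedding = earliest Finset.univ z m := by simp [e]
  have hfun : (fun x => uplink m i (z, x)) = os m i ∘ fun x => x ∘ e := by
    funext x
    change orderStat (earliest Finset.univ z m) x i = orderStat Finset.univ (x ∘ e) i
    rw [← hmap, orderStat_map]
    rfl
  have hcomp := measurePreserving_comp_iidExp hmu e.injective
  rw [hfun, ← Measure.map_map (measurable_os h1 him) hcomp.measurable, hcomp.map_eq]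

theorem integral_wait_mul_uplink (hlam : 0 < lam) (hmu : 0 < mu) (h1 : 1 ≤ i) (him : i ≤ m)
    (hmn : m ≤ n) {f g : ℝ → ℝ} (hf : Measurable f) (hg : Measurable g) :
    ∫ q, f (wait m q) * g (uplink m i q) ∂law lam mu n =
      (∫ z, f (os n m z) ∂iidExp lam n) * ∫ x, g (os m i x) ∂iidExp mu m := by
  have := isProbabilityMeasure_iidExp (N := n) hlam
  have := isProbabilityMeasure_iidExp (N := m) hmu
  have hos1 := measurable_os (h1.trans him) hmn
  have hos2 := measurable_os h1 him
  have hMP := measurePreserving_wait_uplink hlam hmu h1 him hmn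
  have hm : Measurable fun p : ℝ × ℝ => f p.1 * g p.2 := by fun_prop
  rw [← integral_map hos1.aemeasurable hf.aestronglyMeasurable,
    ← integral_map hos2.aemeasurable hg.aestronglyMeasurable, ← integral_prod_mul, ← hMP.map_eq,
    integral_map hMP.measurable.aemeasurable hm.aestronglyMeasurable]

theorem memLp_wait (hlam : 0 < lam) (hmu : 0 < mu) (h1 : 1 ≤ m) (hmn : m ≤ n) :
    MemLp (wait (n := n) m) 2 (law lam mu n) :=
  (memLp_os hlam h1 hmn).comp_measurePreserving (measurePreserving_fst_law hmu)

theorem memLp_snd (hlam : 0 < lam) (hmu : 0 < mu) (j : Fin n) :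
    MemLp (fun q : Block n => q.2 j) 2 (law lam mu n) :=
  (memLp_eval_iidExp hmu j).comp_measurePreserving (measurePreserving_snd_law hlam hmu)

theorem memLp_uplink (hlam : 0 < lam) (hmu : 0 < mu) (h1 : 1 ≤ i) (him : i ≤ m)
    (hmn : m ≤ n) : MemLp (uplink (n := n) m i) 2 (law lam mu n) := by
  have habs : ∀ j : Fin n, MemLp (fun q : Block n => |q.2 j|) 2 (law lam mu n) := fun j =>
    (memLp_snd hlam hmu j).abs
  refine (memLp_finsetSum Finset.univ fun j _ => habs j).mono
    (measurable_uplink h1 him hmn).aestronglyMeasurable (ae_of_all _ fun q => ?_)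
  exact (abs_orderStat_le h1 (le_card_sel h1 him hmn q)).trans (le_abs_self _)

theorem memLp_ind_mul (h1 : 1 ≤ k) (hkm : k ≤ m) (hmn : m ≤ n) (j : Fin n) {p : ENNReal}
    {f : Block n → ℝ} {ν : Measure (Block n)} (hf : MemLp f p ν) :
    MemLp (fun q => ind m k j q * f q) p ν := by
  refine hf.mono ((measurable_ind h1 hkm hmn j).aestronglyMeasurable.mul hf.aestronglyMeasurable)
    (ae_of_all _ fun q => ?_)
  rw [norm_mul]
  exact mul_le_of_le_one_left (norm_nonneg _) (abs_ind_le j q)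

/-- Relabelling the clients by a permutation changes neither the waiting time nor the order
statistics of the uplink delays, and relabels the updating clients. -/
theorem ind_comp (σ : Equiv.Perm (Fin n)) (j : Fin n) (q : Block n) :
    wait m (q.1 ∘ σ, q.2 ∘ σ) = wait m q ∧ uplink m k (q.1 ∘ σ, q.2 ∘ σ) = uplink m k q ∧
      ind m k j (q.1 ∘ σ, q.2 ∘ σ) = ind m k (σ j) q := by
  have huniv : Finset.univ.map σ.toEmbedding = Finset.univ := Finset.map_univ_equiv σ
  have hsel : (sel m (q.1 ∘ σ, q.2 ∘ σ)).map σ.toEmbedding = sel m q := by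
    ext l
    obtain ⟨l, rfl⟩ := σ.surjective l
    have := mem_earliest_map (v := q.1) (i := m) σ.toEmbedding Finset.univ l
    rw [huniv] at this
    simpa [sel] using this.symm
  refine ⟨?_, ?_, ?_⟩
  · have := orderStat_map (v := q.1) (i := m) σ.toEmbedding Finset.univ
    rw [huniv] at this
    exact this.symm
  · have := orderStat_map (v := q.2) (i := k) σ.toEmbedding (sel m (q.1 ∘ σ, q.2 ∘ σ))
    rw [hsel] at this
    exact this.symm
  · have := mem_earliest_map (v := q.2) (i := k) σ.toEmbedding (sel m (q.1 ∘ σ, q.2 ∘ σ)) j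
    rw [hsel] at this
    have h' : j ∈ upd m k (q.1 ∘ σ, q.2 ∘ σ) ↔ σ j ∈ upd m k q := this.symm
    simp only [ind, h']

/-- By symmetry, an expectation on the event that client `j` is updating is the `n`-th part of the
expected sum over all updating clients. -/
theorem integral_ind_mul (hlam : 0 < lam) (hmu : 0 < mu) (h1 : 1 ≤ k) (hkm : k ≤ m) (hmn : m ≤ n)
    (j : Fin n) {Φ : ℝ → ℝ → ℝ → ℝ} (hΦ : Measurable fun p : ℝ × ℝ × ℝ => Φ p.1 p.2.1 p.2.2)
    (hint : ∀ l : Fin n, Integrable (fun q : Block n => Φ (wait m q) (uplink m k q) (q.2 l))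
      (law lam mu n)) :
    ∫ q, ind m k j q * Φ (wait m q) (uplink m k q) (q.2 j) ∂law lam mu n =
      (1 / n) * ∫ q, ∑ l ∈ upd m k q, Φ (wait m q) (uplink m k q) (q.2 l) ∂law lam mu n := by
  have := isProbabilityMeasure_iidExp (N := n) hlam
  have := isProbabilityMeasure_iidExp (N := n) hmu
  have hsymm : ∀ l : Fin n,
      ∫ q, ind m k l q * Φ (wait m q) (uplink m k q) (q.2 l) ∂law lam mu n =
        ∫ q, ind m k j q * Φ (wait m q) (uplink m k q) (q.2 j) ∂law lam mu n := by
    intro l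
    set σ := Equiv.swap j l
    have hT : MeasurePreserving (fun q : Block n => (q.1 ∘ σ, q.2 ∘ σ)) (law lam mu n)
        (law lam mu n) :=
      (measurePreserving_comp_iidExp hlam σ.injective).prod
        (measurePreserving_comp_iidExp hmu σ.injective)
    have hmeas : Measurable fun q : Block n =>
        ind m k j q * Φ (wait m q) (uplink m k q) (q.2 j) := by
      have hx : Measurable fun q : Block n => q.2 j := by fun_prop
      exact (measurable_ind h1 hkm hmn j).mul (hΦ.comp ((measurable_wait (h1.trans hkm) hmn).prodMk
        ((measurable_uplink h1 hkm hmn).prodMk hx)))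
    conv_rhs => rw [← hT.map_eq]
    rw [integral_map hT.measurable.aemeasurable hmeas.aestronglyMeasurable]
    refine integral_congr_ae (ae_of_all _ fun q => ?_)
    obtain ⟨e1, e2, e3⟩ := ind_comp (m := m) (k := k) σ j q
    simp only [e1, e2, e3, Function.comp_apply, σ, Equiv.swap_apply_left]
  have hn : (n : ℝ) ≠ 0 := by
    have : 0 < n := j.pos
    positivity
  have hsum : ∫ q, ∑ l ∈ upd m k q, Φ (wait m q) (uplink m k q) (q.2 l) ∂law lam mu n =
      n * ∫ q, ind m k j q * Φ (wait m q) (uplink m k q) (q.2 j) ∂law lam mu n := by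
    simp only [← sum_ind_mul]
    rw [integral_finsetSum _ fun l _ => memLp_one_iff_integrable.1
      (memLp_ind_mul h1 hkm hmn l (memLp_one_iff_integrable.2 (hint l)))]
    simp [hsymm]
  rw [hsum, one_div, inv_mul_cancel_left₀ hn]

/-- The event that client `j` is updating has probability `k / n` and is independent of the duration
of the iteration. -/
theorem integral_ind_mul_duration (hlam : 0 < lam) (hmu : 0 < mu) (h1 : 1 ≤ k) (hkm : k ≤ m)
    (hmn : m ≤ n) (j : Fin n) {φ : ℝ → ℝ → ℝ} (hφ : Measurable fun p : ℝ × ℝ => φ p.1 p.2)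
    (hint : Integrable (fun q : Block n => φ (wait m q) (uplink m k q)) (law lam mu n)) :
    ∫ q, ind m k j q * φ (wait m q) (uplink m k q) ∂law lam mu n =
      (k / n : ℝ) * ∫ q, φ (wait m q) (uplink m k q) ∂law lam mu n := by
  rw [integral_ind_mul (Φ := fun a b _ => φ a b) hlam hmu h1 hkm hmn j
    (hφ.comp (measurable_fst.prodMk (measurable_fst.comp measurable_snd))) fun _ => hint]
  have hcard : ∀ᵐ q ∂law lam mu n, ∑ l ∈ upd m k q, φ (wait m q) (uplink m k q) =
      k * φ (wait m q) (uplink m k q) := by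
    filter_upwards [(measurePreserving_snd_law hlam hmu).quasiMeasurePreserving.ae
      (ae_injective_iidExp hmu)] with q hq
    rw [Finset.sum_const, upd, card_earliest hq h1 (le_card_sel h1 hkm hmn q), nsmul_eq_mul]
  rw [integral_congr_ae hcard, integral_const_mul]
  ring

/-- The uplink delays of the updating clients are the first `k` order statistics, which are
independent of the waiting time. -/
theorem integral_ind_mul_snd (hlam : 0 < lam) (hmu : 0 < mu) (h1 : 1 ≤ k) (hkm : k ≤ m)
    (hmn : m ≤ n) (j : Fin n) {f : ℝ → ℝ} (hf : Measurable f)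
    (hf2 : MemLp (fun q : Block n => f (wait m q)) 2 (law lam mu n)) :
    ∫ q, ind m k j q * (f (wait m q) * q.2 j) ∂law lam mu n =
      (∫ z, f (os n m z) ∂iidExp lam n) * ((1 / n) * ∑ i ∈ Finset.Icc 1 k, meanOS mu m i) := by
  have := isProbabilityMeasure_iidExp (N := n) hlam
  rw [integral_ind_mul (Φ := fun a _ x => f a * x) hlam hmu h1 hkm hmn j (by fun_prop)
    fun l => hf2.integrable_mul (memLp_snd hlam hmu l)]
  have hsum : ∀ᵐ q ∂law lam mu n, ∑ l ∈ upd m k q, f (wait m q) * q.2 l =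
      ∑ i ∈ Finset.Icc 1 k, f (wait m q) * uplink m i q := by
    filter_upwards [(measurePreserving_snd_law hlam hmu).quasiMeasurePreserving.ae
      (ae_injective_iidExp hmu)] with q hq
    rw [← Finset.mul_sum, ← Finset.mul_sum, upd,
      sum_earliest hq h1 (le_card_sel h1 hkm hmn q)]
    rfl
  have hi : ∀ i ∈ Finset.Icc 1 k, Integrable (fun q : Block n => f (wait m q) * uplink m i q)
      (law lam mu n) := fun i hi => by
    rw [Finset.mem_Icc] at hi
    exact hf2.integrable_mul (memLp_uplink hlam hmu hi.1 (hi.2.trans hkm) hmn)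
  rw [integral_congr_ae hsum, integral_finsetSum _ hi]
  have hval : ∀ i ∈ Finset.Icc 1 k, ∫ q, f (wait m q) * uplink m i q ∂law lam mu n =
      (∫ z, f (os n m z) ∂iidExp lam n) * meanOS mu m i := fun i hi => by
    rw [Finset.mem_Icc] at hi
    exact integral_wait_mul_uplink hlam hmu hi.1 (hi.2.trans hkm) hmn hf measurable_id
  rw [Finset.sum_congr rfl hval, ← Finset.mul_sum]
  ring

end Block

end Block

/-! ### Affine recursions driven by independent innovations -/

section Recursion

/-- The solution of `b (t + 1) = (1 - B (e t)) * b t + U (e t)` with initial value `b₀`. -/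
noncomputable def affineRec {E : Type*} (b₀ : ℝ) (B U : E → ℝ) (e : ℕ → E) : ℕ → ℝ
  | 0 => b₀
  | t + 1 => (1 - B (e t)) * affineRec b₀ B U e t + U (e t)

/-- The σ-algebra generated by the variables `ξ s` with `s < t`. -/
abbrev past {Ω E : Type*} [mE : MeasurableSpace E] (ξ : ℕ → Ω → E) (t : ℕ) : MeasurableSpace Ω :=
  ⨆ s ∈ Set.Iio t, mE.comap (ξ s)

variable {Ω E : Type*} [mE : MeasurableSpace E] {ξ : ℕ → Ω → E} {B U V Q : E → ℝ}

theorem comap_le_past {s t : ℕ} (h : s < t) : mE.comap (ξ s) ≤ past ξ t :=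
  le_iSup₂_of_le s h le_rfl

theorem past_mono {s t : ℕ} (h : s ≤ t) : past ξ s ≤ past ξ t :=
  iSup₂_le fun _ hr => comap_le_past (lt_of_lt_of_le hr h)

theorem measurable_past_comp {g : E → ℝ} (hg : Measurable g) {s t : ℕ} (h : s < t) :
    Measurable[past ξ t] fun ω => g (ξ s ω) :=
  hg.comp (Measurable.mono (comap_measurable (ξ s)) (comap_le_past h) le_rfl)

theorem measurable_past_affineRec (hB : Measurable B) (hU : Measurable U) (b₀ : ℝ) (t : ℕ) :
    Measurable[past ξ t] fun ω => affineRec b₀ B U (fun s => ξ s ω) t := by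
  induction t with
  | zero => exact measurable_const
  | succ t ih =>
    have h1 : Measurable[past ξ (t + 1)] fun ω => affineRec b₀ B U (fun s => ξ s ω) t :=
      Measurable.mono ih (past_mono t.le_succ) le_rfl
    have h2 : Measurable[past ξ (t + 1)] fun ω => (1 - B (ξ t ω)) :=
      measurable_past_comp (measurable_const.sub hB) t.lt_succ_self
    have h3 : Measurable[past ξ (t + 1)] fun ω => U (ξ t ω) :=
      measurable_past_comp hU t.lt_succ_self
    exact (h2.mul h1).add h3

variable [mΩ : MeasurableSpace Ω] {P : Measure Ω} {ν : Measure E}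

theorem past_le (hξ : ∀ t, Measurable (ξ t)) (t : ℕ) : past ξ t ≤ mΩ :=
  iSup₂_le fun s _ => (hξ s).comap_le

theorem indepFun_of_past (hind : ∀ t, Indep (past ξ t) (mE.comap (ξ t)) P) {t : ℕ} {f : Ω → ℝ}
    (hf : Measurable[past ξ t] f) {g : E → ℝ} (hg : Measurable g) :
    IndepFun f (fun ω => g (ξ t ω)) P := by
  rw [IndepFun_iff_Indep]
  exact indep_of_indep_of_le (hind t) hf.comap_le (hg.comp (comap_measurable (ξ t))).comap_le

/-- The strong law of large numbers for a function of the innovations. -/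
theorem ae_tendsto_average_comp (hξ : ∀ t, MeasurePreserving (ξ t) P ν)
    (hind : ∀ t, Indep (past ξ t) (mE.comap (ξ t)) P) {g : E → ℝ} (hg : Measurable g)
    (hgi : Integrable g ν) :
    ∀ᵐ ω ∂P, Tendsto (fun N : ℕ => (∑ t ∈ Finset.range N, g (ξ t ω)) / N) atTop
      (𝓝 (∫ e, g e ∂ν)) := by
  have h := strong_law_ae_real (μ := P) (fun t ω => g (ξ t ω))
    ((hξ 0).integrable_comp_of_integrable hgi) ?_ ?_
  · have hint : ∫ ω, g (ξ 0 ω) ∂P = ∫ e, g e ∂ν := by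
      rw [← (hξ 0).map_eq, integral_map (hξ 0).measurable.aemeasurable hg.aestronglyMeasurable]
    rwa [hint] at h
  · intro s t hst
    rcases lt_or_gt_of_ne hst with h | h
    · exact indepFun_of_past hind (measurable_past_comp hg h) hg
    · exact (indepFun_of_past hind (measurable_past_comp hg h) hg).symm
  · intro t
    exact IdentDistrib.comp ⟨(hξ t).measurable.aemeasurable, (hξ 0).measurable.aemeasurable,
      by rw [(hξ t).map_eq, (hξ 0).map_eq]⟩ hg

theorem integral_past_mul (hξ : ∀ t, MeasurePreserving (ξ t) P ν)
    (hind : ∀ t, Indep (past ξ t) (mE.comap (ξ t)) P) {t : ℕ} {f : Ω → ℝ}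
    (hf : Measurable[past ξ t] f) {g : E → ℝ} (hg : Measurable g) :
    ∫ ω, f ω * g (ξ t ω) ∂P = (∫ ω, f ω ∂P) * ∫ e, g e ∂ν := by
  have hfm : Measurable f := hf.mono (past_le (fun t => (hξ t).measurable) t) le_rfl
  rw [(indepFun_of_past hind hf hg).integral_fun_mul_eq_mul_integral hfm.aestronglyMeasurable
    (hg.comp (hξ t).measurable).aestronglyMeasurable]
  congr 1
  rw [← (hξ t).map_eq, integral_map (hξ t).measurable.aemeasurable hg.aestronglyMeasurable]

theorem memLp_past_mul (hξ : ∀ t, MeasurePreserving (ξ t) P ν)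
    (hind : ∀ t, Indep (past ξ t) (mE.comap (ξ t)) P) {t : ℕ} {f : Ω → ℝ}
    (hf : Measurable[past ξ t] f) (hf2 : MemLp f 2 P) {g : E → ℝ} (hg : Measurable g)
    (hg2 : MemLp g 2 ν) : MemLp (fun ω => f ω * g (ξ t ω)) 2 P := by
  have hfm : Measurable f := hf.mono (past_le (fun t => (hξ t).measurable) t) le_rfl
  have hgm : Measurable fun ω => g (ξ t ω) := hg.comp (hξ t).measurable
  refine (memLp_two_iff_integrable_sq (hfm.mul hgm).aestronglyMeasurable).2 ?_
  have h := (indepFun_of_past hind (hf.pow_const 2) (hg.pow_const 2)).integrable_mul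
    hf2.integrable_sq ((hξ t).integrable_comp_of_integrable hg2.integrable_sq)
  exact h.congr (ae_of_all _ fun ω => (mul_pow _ _ 2).symm)

/-- A constant bounding the second moments of the affine recursion. -/
noncomputable def secondMomentBound (b₀ p u₂ : ℝ) : ℝ := b₀ ^ 2 + (1 + 1 / p) * u₂ / p ^ 2

/-- If `B` is the indicator of an event of probability `p > 0`, the recursion contracts in mean
square: `((1 - B) b + U)² ≤ (1 + p) (1 - B) b² + (1 + 1 / p) U²`, and `(1 + p) (1 - p) < 1`. -/
theorem affineRec_sq_le [IsProbabilityMeasure P] (hξ : ∀ t, MeasurePreserving (ξ t) P ν)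
    (hind : ∀ t, Indep (past ξ t) (mE.comap (ξ t)) P)
    (hB : Measurable B) (hU : Measurable U) (hB01 : ∀ e, B e = 0 ∨ B e = 1)
    (hp : 0 < ∫ e, B e ∂ν) (hU2 : MemLp U 2 ν) (b₀ : ℝ) (t : ℕ) :
    MemLp (fun ω => affineRec b₀ B U (fun s => ξ s ω) t) 2 P ∧
    ∫ ω, affineRec b₀ B U (fun s => ξ s ω) t ^ 2 ∂P ≤
      secondMomentBound b₀ (∫ e, B e ∂ν) (∫ e, U e ^ 2 ∂ν) := by
  have : IsProbabilityMeasure ν := (hξ 0).map_eq ▸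
    Measure.isProbabilityMeasure_map (hξ 0).measurable.aemeasurable
  set p := ∫ e, B e ∂ν with hpdef
  set u₂ := ∫ e, U e ^ 2 ∂ν with hu
  set K := secondMomentBound b₀ p u₂ with hK
  have hu0 : 0 ≤ u₂ := integral_nonneg fun e => sq_nonneg _
  have hB2 : MemLp (fun e => 1 - B e) 2 ν := by
    refine MemLp.of_bound (measurable_const.sub hB).aestronglyMeasurable 1
      (ae_of_all _ fun e => ?_)
    rcases hB01 e with h | h <;> simp [h]
  have hBi : Integrable B ν := by
    refine Integrable.of_bound hB.aestronglyMeasurable 1 (ae_of_all _ fun e => ?_)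
    rcases hB01 e with h | h <;> simp [h]
  have h1p : ∫ e, (1 - B e) ∂ν = 1 - p := by
    rw [integral_sub (integrable_const _) hBi]; simp [hpdef]
  induction t with
  | zero =>
    refine ⟨memLp_const b₀, ?_⟩
    simp only [affineRec, integral_const, probReal_univ, one_smul, hK, secondMomentBound]
    have : 0 ≤ (1 + 1 / p) * u₂ / p ^ 2 := by positivity
    linarith
  | succ t ih =>
    obtain ⟨ih1, ih2⟩ := ih
    set b : Ω → ℝ := fun ω => affineRec b₀ B U (fun s => ξ s ω) t with hb
    have hbm : Measurable[past ξ t] b := measurable_past_affineRec hB hU b₀ t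
    have hb2m : Measurable[past ξ t] fun ω => b ω ^ 2 := hbm.pow_const 2
    have hUξ : MemLp (fun ω => U (ξ t ω)) 2 P := hU2.comp_measurePreserving (hξ t)
    have hUint : ∫ ω, U (ξ t ω) ^ 2 ∂P = u₂ := by
      rw [hu, ← (hξ t).map_eq, integral_map (hξ t).measurable.aemeasurable
        (hU.pow_const 2).aestronglyMeasurable]
    have hprod : MemLp (fun ω => b ω * (1 - B (ξ t ω))) 2 P :=
      memLp_past_mul hξ hind hbm ih1 (measurable_const.sub hB) hB2
    have hnext : MemLp (fun ω => affineRec b₀ B U (fun s => ξ s ω) (t + 1)) 2 P := by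
      refine (hprod.add hUξ).congr_norm ?_ (ae_of_all _ fun ω => ?_)
      · exact ((measurable_past_affineRec hB hU b₀ (t + 1)).mono
          (past_le (fun t => (hξ t).measurable) _) le_rfl).aestronglyMeasurable
      · simp [affineRec, hb, mul_comm]
    refine ⟨hnext, ?_⟩
    have hpt : ∀ ω, affineRec b₀ B U (fun s => ξ s ω) (t + 1) ^ 2 ≤
        (1 + p) * (b ω ^ 2 * (1 - B (ξ t ω))) + (1 + 1 / p) * U (ξ t ω) ^ 2 := by
      intro ω
      have hyoung : ∀ x y : ℝ, (x + y) ^ 2 ≤ (1 + p) * x ^ 2 + (1 + 1 / p) * y ^ 2 := by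
        intro x y
        have h : 0 ≤ (p * x - y) ^ 2 / p := by positivity
        have e : (p * x - y) ^ 2 / p = p * x ^ 2 - 2 * x * y + 1 / p * y ^ 2 := by
          field_simp; ring
        nlinarith
      simp only [affineRec]
      refine (hyoung _ _).trans (le_of_eq ?_)
      rcases hB01 (ξ t ω) with h | h <;> simp [h, hb]
    have hI1 : Integrable (fun ω => b ω ^ 2 * (1 - B (ξ t ω))) P :=
      (indepFun_of_past hind hb2m (measurable_const.sub hB)).integrable_mul ih1.integrable_sq
        ((hξ t).integrable_comp_of_integrable (hB2.integrable one_le_two))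
    calc _ ≤ ∫ ω, ((1 + p) * (b ω ^ 2 * (1 - B (ξ t ω))) + (1 + 1 / p) * U (ξ t ω) ^ 2) ∂P :=
          integral_mono hnext.integrable_sq
            ((hI1.const_mul _).add (hUξ.integrable_sq.const_mul _)) hpt
      _ = (1 + p) * ((∫ ω, b ω ^ 2 ∂P) * (1 - p)) + (1 + 1 / p) * u₂ := by
          rw [integral_add (hI1.const_mul _) (hUξ.integrable_sq.const_mul _), integral_const_mul,
            integral_const_mul, hUint,
            integral_past_mul hξ hind hb2m (g := fun e => 1 - B e) (measurable_const.sub hB), h1p]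
      _ ≤ (1 + p) * (K * (1 - p)) + (1 + 1 / p) * u₂ := by
          have : 0 ≤ 1 - p := by
            rw [← h1p]
            exact integral_nonneg fun e => by rcases hB01 e with h | h <;> simp [h]
          gcongr
      _ ≤ K := by
          have h : p ^ 2 * K = p ^ 2 * b₀ ^ 2 + (1 + 1 / p) * u₂ := by
            rw [hK, secondMomentBound]; field_simp
          nlinarith [mul_nonneg (sq_nonneg p) (sq_nonneg b₀)]

/-- The products of the recursion with centred functions of the current innovation are orthogonal,
so their averages vanish. -/
theorem ae_tendsto_average_affineRec_mul [IsProbabilityMeasure P]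
    (hξ : ∀ t, MeasurePreserving (ξ t) P ν) (hind : ∀ t, Indep (past ξ t) (mE.comap (ξ t)) P)
    (hB : Measurable B) (hU : Measurable U) (hB01 : ∀ e, B e = 0 ∨ B e = 1)
    (hp : 0 < ∫ e, B e ∂ν) (hU2 : MemLp U 2 ν) (b₀ : ℝ) {g : E → ℝ} (hg : Measurable g)
    (hg2 : MemLp g 2 ν) :
    ∀ᵐ ω ∂P, Tendsto (fun N : ℕ => (∑ t ∈ Finset.range N,
      affineRec b₀ B U (fun s => ξ s ω) t * (g (ξ t ω) - ∫ e, g e ∂ν)) / N) atTop (𝓝 0) := by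
  have : IsProbabilityMeasure ν := (hξ 0).map_eq ▸
    Measure.isProbabilityMeasure_map (hξ 0).measurable.aemeasurable
  set h : E → ℝ := fun e => g e - ∫ e, g e ∂ν with hh
  have hhm : Measurable h := hg.sub measurable_const
  have hh2 : MemLp h 2 ν := hg2.sub (memLp_const _)
  have hh0 : ∫ e, h e ∂ν = 0 := by
    rw [hh, integral_sub (hg2.integrable one_le_two) (integrable_const _)]; simp
  have hrec := affineRec_sq_le hξ hind hB hU hB01 hp hU2 b₀
  have hbm := measurable_past_affineRec (ξ := ξ) hB hU b₀
  refine ae_tendsto_average_of_orthogonal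
    (d := fun t ω => affineRec b₀ B U (fun s => ξ s ω) t * h (ξ t ω))
    (K := secondMomentBound b₀ (∫ e, B e ∂ν) (∫ e, U e ^ 2 ∂ν) * ∫ e, h e ^ 2 ∂ν)
    (fun t => memLp_past_mul hξ hind (hbm t) (hrec t).1 hhm hh2) (fun s t hst => ?_) fun t => ?_
  · have hm : Measurable[past ξ t] fun ω => affineRec b₀ B U (fun s => ξ s ω) s * h (ξ s ω) *
        affineRec b₀ B U (fun s => ξ s ω) t :=
      (((hbm s).mono (past_mono hst.le) le_rfl).mul (measurable_past_comp hhm hst)).mul (hbm t)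
    simp only [← mul_assoc]
    rw [integral_past_mul hξ hind hm hhm, hh0, mul_zero]
  · simp only [mul_pow]
    rw [integral_past_mul hξ hind ((hbm t).pow_const 2) (g := fun e => h e ^ 2)
      (hhm.pow_const 2)]
    exact mul_le_mul_of_nonneg_right (hrec t).2 (integral_nonneg fun e => sq_nonneg _)

/-- The almost sure average of `Q (ξ t) + b t * V (ξ t)` along the affine recursion `b`, in which
`B` is the indicator of an event of positive probability. -/
theorem ae_tendsto_average_affineRec [IsProbabilityMeasure P]
    (hξ : ∀ t, MeasurePreserving (ξ t) P ν) (hind : ∀ t, Indep (past ξ t) (mE.comap (ξ t)) P)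
    (hB : Measurable B) (hU : Measurable U) (hV : Measurable V) (hQ : Measurable Q)
    (hB01 : ∀ e, B e = 0 ∨ B e = 1) (hp : 0 < ∫ e, B e ∂ν) (hU2 : MemLp U 2 ν)
    (hV2 : MemLp V 2 ν) (hQi : Integrable Q ν) (b₀ : ℝ) :
    ∀ᵐ ω ∂P, Tendsto (fun N : ℕ => (∑ t ∈ Finset.range N,
      (Q (ξ t ω) + affineRec b₀ B U (fun s => ξ s ω) t * V (ξ t ω))) / N) atTop
      (𝓝 (∫ e, Q e ∂ν + (∫ e, V e ∂ν) * ((∫ e, U e ∂ν) / ∫ e, B e ∂ν))) := by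
  have : IsProbabilityMeasure ν := (hξ 0).map_eq ▸
    Measure.isProbabilityMeasure_map (hξ 0).measurable.aemeasurable
  have hB2 : MemLp B 2 ν := by
    refine MemLp.of_bound hB.aestronglyMeasurable 1 (ae_of_all _ fun e => ?_)
    rcases hB01 e with h | h <;> simp [h]
  have hrec := affineRec_sq_le hξ hind hB hU hB01 hp hU2 b₀
  filter_upwards [ae_tendsto_average_comp hξ hind hU (hU2.integrable one_le_two),
    ae_tendsto_average_comp hξ hind hQ hQi,
    ae_tendsto_average_affineRec_mul hξ hind hB hU hB01 hp hU2 b₀ hB hB2,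
    ae_tendsto_average_affineRec_mul hξ hind hB hU hB01 hp hU2 b₀ hV hV2,
    ae_tendsto_div_of_integral_sq_le (fun t => (hrec t).1) (fun t => (hrec t).2)]
    with ω h1 h2 h3 h4 h5
  exact tendsto_average_of_recursion (b := affineRec b₀ B U (fun s => ξ s ω)) hp.ne'
    (fun t => rfl) h1 h2 h3 h4 h5

end Recursion

/-! ### Expectations over one iteration -/

namespace Block

variable {n m k : ℕ} {c lam mu : ℝ}

/-- The duration of an iteration. -/
noncomputable def duration (m k : ℕ) (c : ℝ) (q : Block n) : ℝ := wait m q + c + uplink m k q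

/-- The inhomogeneous term in the recursion for the age at the completion of iterations: the duration
if client `j` is not updating and the `k`-th uplink delay if it is. -/
noncomputable def ageInput (m k : ℕ) (c : ℝ) (j : Fin n) (q : Block n) : ℝ :=
  duration m k c q - ind m k j q * (wait m q + c)

/-- The time from the beginning of an iteration until an update of client `j` is received, or until
the iteration is complete if `j` is not updating. -/
noncomputable def staleTime (m k : ℕ) (c : ℝ) (j : Fin n) (q : Block n) : ℝ :=
  duration m k c q - ind m k j q * uplink m k q + ind m k j q * q.2 j

/-- The area under the age during an iteration that begins with age `0`. -/
noncomputable def baseArea (m k : ℕ) (c : ℝ) (j : Fin n) (q : Block n) : ℝ :=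
  duration m k c q ^ 2 / 2 - ind m k j q * ((wait m q + c) * uplink m k q)
    + ind m k j q * ((wait m q + c) * q.2 j)

theorem measurable_duration (h1 : 1 ≤ k) (hkm : k ≤ m) (hmn : m ≤ n) :
    Measurable (duration (n := n) m k c) :=
  ((measurable_wait (h1.trans hkm) hmn).add measurable_const).add (measurable_uplink h1 hkm hmn)

theorem measurable_ageInput (h1 : 1 ≤ k) (hkm : k ≤ m) (hmn : m ≤ n) (j : Fin n) :
    Measurable (ageInput m k c j) :=
  (measurable_duration h1 hkm hmn).sub ((measurable_ind h1 hkm hmn j).mul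
    ((measurable_wait (h1.trans hkm) hmn).add measurable_const))

theorem measurable_snd_apply (j : Fin n) : Measurable fun q : Block n => q.2 j := by fun_prop

theorem measurable_staleTime (h1 : 1 ≤ k) (hkm : k ≤ m) (hmn : m ≤ n) (j : Fin n) :
    Measurable (staleTime m k c j) :=
  ((measurable_duration h1 hkm hmn).sub ((measurable_ind h1 hkm hmn j).mul
    (measurable_uplink h1 hkm hmn))).add ((measurable_ind h1 hkm hmn j).mul
    (measurable_snd_apply j))

theorem measurable_baseArea (h1 : 1 ≤ k) (hkm : k ≤ m) (hmn : m ≤ n) (j : Fin n) :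
    Measurable (baseArea m k c j) := by
  have hw := (measurable_wait (n := n) (h1.trans hkm) hmn).add_const c
  have hi := measurable_ind h1 hkm hmn j
  exact ((((measurable_duration h1 hkm hmn).pow_const 2).div_const 2).sub
    (hi.mul (hw.mul (measurable_uplink h1 hkm hmn)))).add (hi.mul (hw.mul (measurable_snd_apply j)))

theorem ind_eq_zero_or_one (j : Fin n) (q : Block n) : ind m k j q = 0 ∨ ind m k j q = 1 := by
  unfold ind; split_ifs <;> simp

theorem memLp_wait_add (hlam : 0 < lam) (hmu : 0 < mu) (h1 : 1 ≤ m) (hmn : m ≤ n) :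
    MemLp (fun q : Block n => wait m q + c) 2 (law lam mu n) := by
  have := isProbabilityMeasure_law (n := n) hlam hmu
  exact (memLp_wait hlam hmu h1 hmn).add (memLp_const c)

theorem memLp_duration (hlam : 0 < lam) (hmu : 0 < mu) (h1 : 1 ≤ k) (hkm : k ≤ m) (hmn : m ≤ n) :
    MemLp (duration (n := n) m k c) 2 (law lam mu n) :=
  (memLp_wait_add hlam hmu (h1.trans hkm) hmn).add (memLp_uplink hlam hmu h1 hkm hmn)

theorem memLp_ageInput (hlam : 0 < lam) (hmu : 0 < mu) (h1 : 1 ≤ k) (hkm : k ≤ m) (hmn : m ≤ n)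
    (j : Fin n) : MemLp (ageInput m k c j) 2 (law lam mu n) :=
  (memLp_duration hlam hmu h1 hkm hmn).sub
    (memLp_ind_mul h1 hkm hmn j (memLp_wait_add hlam hmu (h1.trans hkm) hmn))

theorem memLp_staleTime (hlam : 0 < lam) (hmu : 0 < mu) (h1 : 1 ≤ k) (hkm : k ≤ m) (hmn : m ≤ n)
    (j : Fin n) : MemLp (staleTime m k c j) 2 (law lam mu n) :=
  ((memLp_duration hlam hmu h1 hkm hmn).sub
    (memLp_ind_mul h1 hkm hmn j (memLp_uplink hlam hmu h1 hkm hmn))).add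
    (memLp_ind_mul h1 hkm hmn j (memLp_snd hlam hmu j))

theorem integrable_ind_mul (h1 : 1 ≤ k) (hkm : k ≤ m) (hmn : m ≤ n) (j : Fin n)
    {f : Block n → ℝ} {ν : Measure (Block n)} (hf : Integrable f ν) :
    Integrable (fun q => ind m k j q * f q) ν :=
  memLp_one_iff_integrable.1 (memLp_ind_mul h1 hkm hmn j (memLp_one_iff_integrable.2 hf))

theorem integrable_wait_mul_uplink (hlam : 0 < lam) (hmu : 0 < mu) (h1 : 1 ≤ k) (hkm : k ≤ m)
    (hmn : m ≤ n) :
    Integrable (fun q : Block n => (wait m q + c) * uplink m k q) (law lam mu n) :=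
  (memLp_wait_add hlam hmu (h1.trans hkm) hmn).integrable_mul (memLp_uplink hlam hmu h1 hkm hmn)

theorem integrable_wait_mul_snd (hlam : 0 < lam) (hmu : 0 < mu) (h1 : 1 ≤ m) (hmn : m ≤ n)
    (j : Fin n) : Integrable (fun q : Block n => (wait m q + c) * q.2 j) (law lam mu n) :=
  (memLp_wait_add hlam hmu h1 hmn).integrable_mul (memLp_snd hlam hmu j)

theorem integrable_half_sq_duration (hlam : 0 < lam) (hmu : 0 < mu) (h1 : 1 ≤ k) (hkm : k ≤ m)
    (hmn : m ≤ n) : Integrable (fun q : Block n => duration m k c q ^ 2 / 2) (law lam mu n) :=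
  (memLp_duration hlam hmu h1 hkm hmn).integrable_sq.div_const 2

theorem integrable_baseArea (hlam : 0 < lam) (hmu : 0 < mu) (h1 : 1 ≤ k) (hkm : k ≤ m)
    (hmn : m ≤ n) (j : Fin n) : Integrable (baseArea m k c j) (law lam mu n) :=
  ((integrable_half_sq_duration hlam hmu h1 hkm hmn).sub
    (integrable_ind_mul h1 hkm hmn j (integrable_wait_mul_uplink hlam hmu h1 hkm hmn))).add
    (integrable_ind_mul h1 hkm hmn j (integrable_wait_mul_snd hlam hmu (h1.trans hkm) hmn j))

theorem integral_wait (hlam : 0 < lam) (hmu : 0 < mu) (h1 : 1 ≤ m) (hmn : m ≤ n) :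
    ∫ q, wait m q ∂law lam mu n = meanOS lam n m := by
  have := isProbabilityMeasure_iidExp (N := m) hmu
  have h := integral_wait_mul_uplink hlam hmu h1 le_rfl hmn measurable_id
    (measurable_const (a := (1 : ℝ)))
  simpa [meanOS] using h

theorem integral_uplink (hlam : 0 < lam) (hmu : 0 < mu) (h1 : 1 ≤ k) (hkm : k ≤ m) (hmn : m ≤ n) :
    ∫ q, uplink (n := n) m k q ∂law lam mu n = meanOS mu m k := by
  have := isProbabilityMeasure_iidExp (N := n) hlam
  have h := integral_wait_mul_uplink hlam hmu h1 hkm hmn (measurable_const (a := (1 : ℝ)))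
    measurable_id
  simpa [meanOS] using h

theorem integral_wait_add (hlam : 0 < lam) (hmu : 0 < mu) (h1 : 1 ≤ m) (hmn : m ≤ n) :
    ∫ q : Block n, (wait m q + c) ∂law lam mu n = meanOS lam n m + c := by
  have := isProbabilityMeasure_law (n := n) hlam hmu
  rw [integral_add ((memLp_wait hlam hmu h1 hmn).integrable one_le_two) (integrable_const _),
    integral_wait hlam hmu h1 hmn]
  simp

theorem integral_duration (hlam : 0 < lam) (hmu : 0 < mu) (h1 : 1 ≤ k) (hkm : k ≤ m)
    (hmn : m ≤ n) : ∫ q : Block n, duration m k c q ∂law lam mu n =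
      c + meanOS mu m k + meanOS lam n m := by
  have := isProbabilityMeasure_law (n := n) hlam hmu
  simp only [duration]
  rw [integral_add ((memLp_wait_add hlam hmu (h1.trans hkm) hmn).integrable one_le_two)
    ((memLp_uplink hlam hmu h1 hkm hmn).integrable one_le_two),
    integral_wait_add hlam hmu (h1.trans hkm) hmn, integral_uplink hlam hmu h1 hkm hmn]
  ring

theorem integral_wait_add_mul_uplink (hlam : 0 < lam) (hmu : 0 < mu) (h1 : 1 ≤ k) (hkm : k ≤ m)
    (hmn : m ≤ n) : ∫ q : Block n, (wait m q + c) * uplink m k q ∂law lam mu n =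
      (meanOS lam n m + c) * meanOS mu m k := by
  have := isProbabilityMeasure_iidExp (N := n) hlam
  have h := integral_wait_mul_uplink hlam hmu h1 hkm hmn (measurable_id.add_const c) measurable_id
  simp only [id_eq] at h
  rw [h, integral_add ((memLp_os hlam (h1.trans hkm) hmn).integrable one_le_two)
    (integrable_const _)]
  simp [meanOS]

theorem integral_os_sq {r : ℝ} (hr : 0 < r) {N i : ℕ} (h1 : 1 ≤ i) (h2 : i ≤ N) :
    ∫ v, os N i v ^ 2 ∂iidExp r N = varOS r N i + meanOS r N i ^ 2 := by
  have := isProbabilityMeasure_iidExp (N := N) hr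
  rw [varOS, variance_eq_sub (memLp_os hr h1 h2), meanOS]
  simp

theorem integral_duration_sq (hlam : 0 < lam) (hmu : 0 < mu) (h1 : 1 ≤ k) (hkm : k ≤ m)
    (hmn : m ≤ n) : ∫ q : Block n, duration m k c q ^ 2 ∂law lam mu n =
      varOS mu m k + varOS lam n m + (c + meanOS mu m k + meanOS lam n m) ^ 2 := by
  have := isProbabilityMeasure_law (n := n) hlam hmu
  have := isProbabilityMeasure_iidExp (N := n) hlam
  have := isProbabilityMeasure_iidExp (N := m) hmu
  have hW2 : ∫ q : Block n, (wait m q + c) ^ 2 ∂law lam mu n =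
      varOS lam n m + (meanOS lam n m + c) ^ 2 := by
    have hL := memLp_wait hlam hmu (h1.trans hkm) hmn
    have hsq := integral_wait_mul_uplink hlam hmu (h1.trans hkm) le_rfl hmn
      (measurable_id.pow_const 2) (measurable_const (a := (1 : ℝ)))
    simp only [id_eq, mul_one, integral_const, probReal_univ, smul_eq_mul] at hsq
    have hexp : ∀ q : Block n, (wait m q + c) ^ 2 = wait m q ^ 2 + (2 * c * wait m q + c ^ 2) :=
      fun q => by ring
    have hi : Integrable (fun q : Block n => 2 * c * wait m q) (law lam mu n) :=
      (hL.integrable one_le_two).const_mul _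
    have hi' : Integrable (fun q : Block n => 2 * c * wait m q + c ^ 2) (law lam mu n) :=
      hi.add (integrable_const _)
    simp only [hexp]
    rw [integral_add hL.integrable_sq hi', integral_add hi (integrable_const _),
      integral_const_mul, hsq, integral_wait hlam hmu (h1.trans hkm) hmn,
      integral_os_sq hlam (h1.trans hkm) hmn]
    simp only [integral_const, probReal_univ, smul_eq_mul]
    ring
  have hY2 : ∫ q : Block n, uplink m k q ^ 2 ∂law lam mu n =
      varOS mu m k + meanOS mu m k ^ 2 := by
    have hsq := integral_wait_mul_uplink hlam hmu h1 hkm hmn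
      (measurable_const (a := (1 : ℝ))) (measurable_id.pow_const 2)
    simp only [id_eq, one_mul, integral_const, probReal_univ, smul_eq_mul] at hsq
    rw [hsq, integral_os_sq hmu h1 hkm]
  have hexp : ∀ q : Block n, duration m k c q ^ 2 =
      (wait m q + c) ^ 2 + (2 * ((wait m q + c) * uplink m k q) + uplink m k q ^ 2) :=
    fun q => by rw [duration]; ring
  have hi1 := (memLp_wait_add (c := c) hlam hmu (h1.trans hkm) hmn).integrable_sq
  have hi2 := (integrable_wait_mul_uplink (c := c) hlam hmu h1 hkm hmn).const_mul 2
  have hi3 := (memLp_uplink (n := n) hlam hmu h1 hkm hmn).integrable_sq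
  have hi4 : Integrable (fun q : Block n => 2 * ((wait m q + c) * uplink m k q) +
      uplink m k q ^ 2) (law lam mu n) := hi2.add hi3
  simp only [hexp]
  rw [integral_add hi1 hi4, integral_add hi2 hi3, integral_const_mul, hW2, hY2,
    integral_wait_add_mul_uplink hlam hmu h1 hkm hmn]
  ring

theorem integral_ind (hlam : 0 < lam) (hmu : 0 < mu) (h1 : 1 ≤ k) (hkm : k ≤ m) (hmn : m ≤ n)
    (j : Fin n) : ∫ q, ind m k j q ∂law lam mu n = k / n := by
  have := isProbabilityMeasure_law (n := n) hlam hmu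
  have h := integral_ind_mul_duration hlam hmu h1 hkm hmn j (φ := fun _ _ => 1) measurable_const
    (integrable_const _)
  simpa using h

theorem integral_ageInput (hlam : 0 < lam) (hmu : 0 < mu) (h1 : 1 ≤ k) (hkm : k ≤ m) (hmn : m ≤ n)
    (j : Fin n) : ∫ q, ageInput m k c j q ∂law lam mu n =
      (c + meanOS mu m k + meanOS lam n m) - k / n * (meanOS lam n m + c) := by
  have := isProbabilityMeasure_law (n := n) hlam hmu
  have hw := (memLp_wait_add (c := c) hlam hmu (h1.trans hkm) hmn).integrable one_le_two
  simp only [ageInput]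
  rw [integral_sub ((memLp_duration hlam hmu h1 hkm hmn).integrable one_le_two)
    (integrable_ind_mul h1 hkm hmn j hw), integral_duration hlam hmu h1 hkm hmn,
    integral_ind_mul_duration hlam hmu h1 hkm hmn j (φ := fun a _ => a + c) (by fun_prop) hw,
    integral_wait_add hlam hmu (h1.trans hkm) hmn]

theorem integral_staleTime (hlam : 0 < lam) (hmu : 0 < mu) (h1 : 1 ≤ k) (hkm : k ≤ m)
    (hmn : m ≤ n) (j : Fin n) : ∫ q, staleTime m k c j q ∂law lam mu n =
      (c + meanOS mu m k + meanOS lam n m) - k / n * meanOS mu m k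
        + (1 / n) * ∑ i ∈ Finset.Icc 1 k, meanOS mu m i := by
  have := isProbabilityMeasure_law (n := n) hlam hmu
  have := isProbabilityMeasure_iidExp (N := n) hlam
  have hd := (memLp_duration (n := n) (c := c) hlam hmu h1 hkm hmn).integrable one_le_two
  have hy := (memLp_uplink (n := n) hlam hmu h1 hkm hmn).integrable one_le_two
  have hx := (memLp_snd (lam := lam) hlam hmu j).integrable one_le_two
  have hix : ∫ q, ind m k j q * q.2 j ∂law lam mu n =
      (1 / n) * ∑ i ∈ Finset.Icc 1 k, meanOS mu m i := by
    simpa using integral_ind_mul_snd hlam hmu h1 hkm hmn j (f := fun _ => 1) measurable_const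
      (memLp_const _)
  have hiy := integrable_ind_mul h1 hkm hmn j hy
  have hdiff : Integrable (fun q => duration m k c q - ind m k j q * uplink m k q)
      (law lam mu n) := hd.sub hiy
  simp only [staleTime]
  rw [integral_add hdiff (integrable_ind_mul h1 hkm hmn j hx), integral_sub hd hiy,
    integral_duration hlam hmu h1 hkm hmn,
    integral_ind_mul_duration hlam hmu h1 hkm hmn j (φ := fun _ b => b) (by fun_prop) hy,
    integral_uplink hlam hmu h1 hkm hmn, hix]

theorem integral_baseArea (hlam : 0 < lam) (hmu : 0 < mu) (h1 : 1 ≤ k) (hkm : k ≤ m)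
    (hmn : m ≤ n) (j : Fin n) : ∫ q, baseArea m k c j q ∂law lam mu n =
      (varOS mu m k + varOS lam n m + (c + meanOS mu m k + meanOS lam n m) ^ 2) / 2
        - k / n * ((meanOS lam n m + c) * meanOS mu m k)
        + (meanOS lam n m + c) * ((1 / n) * ∑ i ∈ Finset.Icc 1 k, meanOS mu m i) := by
  have := isProbabilityMeasure_law (n := n) hlam hmu
  have := isProbabilityMeasure_iidExp (N := n) hlam
  have hd := integrable_half_sq_duration (c := c) hlam hmu h1 hkm hmn
  have hy := integrable_wait_mul_uplink (c := c) hlam hmu h1 hkm hmn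
  have hiy := integrable_ind_mul h1 hkm hmn j hy
  have hix := integrable_ind_mul h1 hkm hmn j
    (integrable_wait_mul_snd (c := c) hlam hmu (h1.trans hkm) hmn j)
  have hos : ∫ z, (os n m z + c) ∂iidExp lam n = meanOS lam n m + c := by
    rw [integral_add ((memLp_os hlam (h1.trans hkm) hmn).integrable one_le_two)
      (integrable_const _)]
    simp [meanOS]
  have hdiff : Integrable (fun q => duration m k c q ^ 2 / 2 -
      ind m k j q * ((wait m q + c) * uplink m k q)) (law lam mu n) := hd.sub hiy
  simp only [baseArea]
  rw [integral_add hdiff hix, integral_sub hd hiy, integral_div,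
    integral_duration_sq hlam hmu h1 hkm hmn,
    integral_ind_mul_duration hlam hmu h1 hkm hmn j (φ := fun a b => (a + c) * b) (by fun_prop) hy,
    integral_wait_add_mul_uplink hlam hmu h1 hkm hmn,
    integral_ind_mul_snd hlam hmu h1 hkm hmn j (f := fun a => a + c) (by fun_prop)
      (memLp_wait_add hlam hmu (h1.trans hkm) hmn), hos]

end Block

/-! ### The delays of the iterations -/

section Delays

variable {Ω : Type*} {n m k : ℕ} {lam mu : ℝ} {Z X : ℕ → Fin n → Ω → ℝ}

/-- The delays of iteration `t` as a random variable. -/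
def delays (Z X : ℕ → Fin n → Ω → ℝ) (t : ℕ) (ω : Ω) : Block n :=
  (fun j => Z t j ω, fun j => X t j ω)

/-- The family of all delays. -/
abbrev allDelays (Z X : ℕ → Fin n → Ω → ℝ) : (ℕ × Fin n) ⊕ (ℕ × Fin n) → Ω → ℝ :=
  Sum.elim (fun p => Z p.1 p.2) (fun p => X p.1 p.2)

theorem measurable_iSup_comap_allDelays {S : Set ((ℕ × Fin n) ⊕ (ℕ × Fin n))} {i} (hi : i ∈ S) :
    Measurable[⨆ i ∈ S, MeasurableSpace.comap (allDelays Z X i) inferInstance]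
      (allDelays Z X i) :=
  Measurable.mono (comap_measurable _)
    (le_iSup₂_of_le (f := fun i (_ : i ∈ S) =>
      MeasurableSpace.comap (allDelays Z X i) inferInstance) i hi le_rfl) le_rfl

theorem measurable_of_apply {ι : Type*} {M : MeasurableSpace Ω} {f : Ω → ι → ℝ}
    (hf : ∀ i, Measurable[M] fun ω => f ω i) : Measurable[M] f := measurable_pi_lambda _ hf

variable [mΩ : MeasurableSpace Ω] {P : Measure Ω}

theorem measurable_allDelays (hZ_meas : ∀ t j, Measurable (Z t j))
    (hX_meas : ∀ t j, Measurable (X t j)) (i) : Measurable (allDelays Z X i) := by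
  rcases i with p | p
  · exact hZ_meas p.1 p.2
  · exact hX_meas p.1 p.2

theorem indep_iSup_comap_allDelays (hZ_meas : ∀ t j, Measurable (Z t j))
    (hX_meas : ∀ t j, Measurable (X t j)) (h_indep : iIndepFun (allDelays Z X) P)
    {S T : Set ((ℕ × Fin n) ⊕ (ℕ × Fin n))} (hST : Disjoint S T) :
    Indep (⨆ i ∈ S, MeasurableSpace.comap (allDelays Z X i) inferInstance)
      (⨆ i ∈ T, MeasurableSpace.comap (allDelays Z X i) inferInstance) P :=
  indep_iSup_of_disjoint (fun i => (measurable_allDelays hZ_meas hX_meas i).comap_le)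
    h_indep.iIndep hST

theorem measurePreserving_delays [IsProbabilityMeasure P] (hZ_meas : ∀ t j, Measurable (Z t j))
    (hX_meas : ∀ t j, Measurable (X t j)) (hZ_law : ∀ t j, P.map (Z t j) = expMeasure lam)
    (hX_law : ∀ t j, P.map (X t j) = expMeasure mu) (h_indep : iIndepFun (allDelays Z X) P)
    (t : ℕ) : MeasurePreserving (delays Z X t) P (Block.law lam mu n) := by
  have hz : Measurable fun ω j => Z t j ω := measurable_pi_lambda _ fun j => hZ_meas t j
  have hx : Measurable fun ω j => X t j ω := measurable_pi_lambda _ fun j => hX_meas t j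
  refine ⟨hz.prodMk hx, ?_⟩
  have hind : IndepFun (fun ω j => Z t j ω) (fun ω j => X t j ω) P := by
    rw [IndepFun_iff_Indep]
    refine indep_of_indep_of_le (indep_iSup_comap_allDelays hZ_meas hX_meas h_indep
      (S := Set.range Sum.inl) (T := Set.range Sum.inr) Set.isCompl_range_inl_range_inr.disjoint)
      (Measurable.comap_le ?_) (Measurable.comap_le ?_)
    · exact measurable_of_apply fun j =>
        measurable_iSup_comap_allDelays (i := Sum.inl (t, j)) ⟨_, rfl⟩
    · exact measurable_of_apply fun j =>
        measurable_iSup_comap_allDelays (i := Sum.inr (t, j)) ⟨_, rfl⟩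
  have hmapZ : P.map (fun ω j => Z t j ω) = iidExp lam n := by
    have h := (h_indep.precomp (g := fun j : Fin n => Sum.inl (t, j))
      (fun a b hab => by simpa using hab)).map_fun_eq_pi_map (fun j => (hZ_meas t j).aemeasurable)
    simp only [hZ_law] at h
    exact h
  have hmapX : P.map (fun ω j => X t j ω) = iidExp mu n := by
    have h := (h_indep.precomp (g := fun j : Fin n => Sum.inr (t, j))
      (fun a b hab => by simpa using hab)).map_fun_eq_pi_map (fun j => (hX_meas t j).aemeasurable)
    simp only [hX_law] at h
    exact h
  have h := hind.map_prod_eq_prod_map_map hz.aemeasurable hx.aemeasurable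
  rw [hmapZ, hmapX] at h
  exact h

theorem indep_past_delays (hZ_meas : ∀ t j, Measurable (Z t j))
    (hX_meas : ∀ t j, Measurable (X t j)) (h_indep : iIndepFun (allDelays Z X) P) (t : ℕ) :
    Indep (past (delays Z X) t) (MeasurableSpace.comap (delays Z X t) inferInstance) P := by
  set iter : (ℕ × Fin n) ⊕ (ℕ × Fin n) → ℕ := Sum.elim Prod.fst Prod.fst
  have hmeas : ∀ (S : Set ((ℕ × Fin n) ⊕ (ℕ × Fin n))) (s : ℕ), (∀ i, iter i = s → i ∈ S) →
      MeasurableSpace.comap (delays Z X s) inferInstance ≤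
        ⨆ i ∈ S, MeasurableSpace.comap (allDelays Z X i) inferInstance := by
    intro S s hS
    refine Measurable.comap_le (Measurable.prodMk ?_ ?_)
    · exact measurable_of_apply fun j =>
        measurable_iSup_comap_allDelays (i := Sum.inl (s, j)) (hS _ rfl)
    · exact measurable_of_apply fun j =>
        measurable_iSup_comap_allDelays (i := Sum.inr (s, j)) (hS _ rfl)
  refine indep_of_indep_of_le (indep_iSup_comap_allDelays hZ_meas hX_meas h_indep
    (S := {i | iter i < t}) (T := {i | iter i = t}) ?_) (iSup₂_le fun s hs => ?_) ?_
  · exact Set.disjoint_left.2 fun i h1 h2 => (ne_of_lt h1) h2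
  · exact hmeas _ s fun i hi => lt_of_eq_of_lt hi hs
  · exact hmeas _ t fun i hi => hi

/-- The run of the scheme with given delays. -/
abbrev runOf (m k : ℕ) (c : ℝ) (q : ℕ → Block n) : Run n :=
  { m := m, k := k, c := c, z := fun t => (q t).1, x := fun t => (q t).2 }

theorem readyAge_runOf (c u₀ : ℝ) (q : ℕ → Block n) (j : Fin n) (t : ℕ) :
    (runOf m k c q).readyAge u₀ j t =
      affineRec (-u₀) (Block.ind m k j) (Block.ageInput m k c j) q t := by
  induction t with
  | zero => rfl
  | succ t ih =>
    have hupd : (runOf m k c q).updating t = Block.upd m k (q t) := rfl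
    have hY : (runOf m k c q).uplinkTime t = Block.uplink m k (q t) := rfl
    have hD : (runOf m k c q).duration t = Block.duration m k c (q t) := rfl
    rw [Run.readyAge, affineRec, ih, hupd, hY, hD, Block.ageInput, Block.ind, Block.duration]
    split_ifs <;> ring

theorem integral_age_runOf {c u₀ : ℝ} (hu : u₀ ≤ 0) {q : ℕ → Block n}
    (hR : (runOf m k c q).Admissible) (j : Fin n) (t : ℕ) :
    ∫ τ in (runOf m k c q).readyTime t..(runOf m k c q).readyTime (t + 1),
        (runOf m k c q).age u₀ j τ =
      Block.baseArea m k c j (q t) +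
        affineRec (-u₀) (Block.ind m k j) (Block.ageInput m k c j) q t *
          Block.staleTime m k c j (q t) := by
  have hupd : (runOf m k c q).updating t = Block.upd m k (q t) := rfl
  have hW : (runOf m k c q).waitTime t = Block.wait m (q t) := rfl
  have hY : (runOf m k c q).uplinkTime t = Block.uplink m k (q t) := rfl
  have hD : (runOf m k c q).duration t = Block.duration m k c (q t) := rfl
  rw [(hR.integral_age_iteration hu j t).2, readyAge_runOf, hupd, hW, hY, hD, Block.baseArea,
    Block.staleTime, Block.ind, Block.duration]
  split_ifs <;> ring

end Delays

end TimelyFL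

theorem theorem1 {Ω : Type*} [MeasurableSpace Ω] (P : Measure Ω) [IsProbabilityMeasure P]
    (n m k : ℕ) (hk : 1 ≤ k) (hkm : k ≤ m) (hmn : m ≤ n)
    (c lam mu : ℝ) (hc : 0 ≤ c) (hlam : 0 < lam) (hmu : 0 < mu)
    -- availability times and uplink delays, indexed by iteration and client
    (Z X : ℕ → Fin n → Ω → ℝ)
    (hZ_meas : ∀ t j, Measurable (Z t j)) (hX_meas : ∀ t j, Measurable (X t j))
    (hZ_law : ∀ t j, P.map (Z t j) = expMeasure lam)
    (hX_law : ∀ t j, P.map (X t j) = expMeasure mu)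
    (h_indep : iIndepFun
      (Sum.elim (fun p : ℕ × Fin n => Z p.1 p.2) (fun p : ℕ × Fin n => X p.1 p.2)) P)
    -- generation times of the information held by the server at time zero
    (u₀ : Fin n → ℝ) (hu₀ : ∀ j, u₀ j ≤ 0) :
    (∀ i ∈ Finset.Icc 1 k, MemLp (TimelyFL.os m i) 2 (TimelyFL.iidExp mu m)) ∧
    MemLp (TimelyFL.os n m) 2 (TimelyFL.iidExp lam n) ∧
    0 < c + TimelyFL.meanOS mu m k + TimelyFL.meanOS lam n m ∧
    ∀ j : Fin n, ∀ᵐ ω ∂P,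
      TimelyFL.IsLongTermAverage
        (TimelyFL.Run.age
          { m := m, k := k, c := c, z := fun t i => Z t i ω, x := fun t i => X t i ω }
          (u₀ j) j)
        ((1 / (k : ℝ)) * ∑ i ∈ Finset.Icc 1 k, TimelyFL.meanOS mu m i
          + (2 * (n : ℝ) - k) / (2 * k)
            * (c + TimelyFL.meanOS mu m k + TimelyFL.meanOS lam n m)
          + (TimelyFL.varOS mu m k + TimelyFL.varOS lam n m)
            / (2 * (c + TimelyFL.meanOS mu m k + TimelyFL.meanOS lam n m))) := by
  open TimelyFL in
  have hl : 0 < c + meanOS mu m k + meanOS lam n m := by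
    have := meanOS_pos hmu hk hkm
    have := meanOS_pos hlam (hk.trans hkm) hmn
    linarith
  refine ⟨fun i hi => ?_, memLp_os hlam (hk.trans hkm) hmn, hl, fun j => ?_⟩
  · rw [Finset.mem_Icc] at hi
    exact memLp_os hmu hi.1 (hi.2.trans hkm)
  have hξ := measurePreserving_delays hZ_meas hX_meas hZ_law hX_law h_indep
  have hind := indep_past_delays hZ_meas hX_meas h_indep
  have hk0 : (0 : ℝ) < k := by exact_mod_cast hk
  have hn0 : (0 : ℝ) < n := by exact_mod_cast hk.trans (hkm.trans hmn)
  have hp : 0 < ∫ q, Block.ind m k j q ∂Block.law lam mu n := by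
    rw [Block.integral_ind hlam hmu hk hkm hmn j]
    positivity
  have hz_pos : ∀ᵐ ω ∂P, ∀ t i, 0 < Z t i ω := ae_all_iff.2 fun t =>
    ((Block.measurePreserving_fst_law hmu).comp (hξ t)).quasiMeasurePreserving.ae
      (ae_pos_iidExp hlam)
  have hx_pos : ∀ᵐ ω ∂P, ∀ t i, 0 < X t i ω := ae_all_iff.2 fun t =>
    ((Block.measurePreserving_snd_law hlam hmu).comp (hξ t)).quasiMeasurePreserving.ae
      (ae_pos_iidExp hmu)
  have := Block.isProbabilityMeasure_law (n := n) hlam hmu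
  filter_upwards [hz_pos, hx_pos,
    ae_tendsto_average_comp hξ hind (Block.measurable_duration (c := c) hk hkm hmn)
      ((Block.memLp_duration hlam hmu hk hkm hmn).integrable one_le_two),
    ae_tendsto_average_affineRec hξ hind (Block.measurable_ind hk hkm hmn j)
      (Block.measurable_ageInput (c := c) hk hkm hmn j)
      (Block.measurable_staleTime (c := c) hk hkm hmn j)
      (Block.measurable_baseArea (c := c) hk hkm hmn j)
      (Block.ind_eq_zero_or_one j) hp
      (Block.memLp_ageInput hlam hmu hk hkm hmn j) (Block.memLp_staleTime hlam hmu hk hkm hmn j)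
      (Block.integrable_baseArea hlam hmu hk hkm hmn j) (-u₀ j)] with ω hz hx hdur harea
  have hR : (runOf m k c fun t => delays Z X t ω).Admissible :=
    ⟨hk, hkm, hmn, hc, hz, hx⟩
  rw [Block.integral_duration hlam hmu hk hkm hmn] at hdur
  have h := isLongTermAverage_of_tendsto hl (fun τ hτ => hR.age_nonneg (hu₀ j) j hτ)
    (by simp [Run.readyTime]) hR.monotone_readyTime
    (fun N => (hR.integral_age (hu₀ j) j N).1) hdur
    (harea.congr fun N => by
      rw [(hR.integral_age (hu₀ j) j N).2]
      simp only [integral_age_runOf (hu₀ j) hR])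
  refine (congrArg (IsLongTermAverage _) ?_).mpr h
  rw [Block.integral_baseArea hlam hmu hk hkm hmn, Block.integral_staleTime hlam hmu hk hkm hmn,
    Block.integral_ageInput hlam hmu hk hkm hmn, Block.integral_ind hlam hmu hk hkm hmn]
  have hl' := hl.ne'
  field_simp
  ring
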